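/- Let $m\ge 1$ and let $\sigma_1,\dots,\sigma_m$ be Borel measures on $\mathbb{R}$, each of constant sign, with infinite support and with finite moments of all orders. Put $\Delta_j=\mathrm{Co}(\mathrm{supp}\,\sigma_j)$ for $1\le j\le m$ and $\Delta_{m+1}=\emptyset$, and let $\overset{\circ}{\Delta}_j$ be the interior of $\Delta_j$ in $\mathbb{R}$. Write $\widehat{s}(z)=\int\frac{ds(x)}{z-x}$ for the Cauchy transform of $s$, and define recursively $s_{j,j}=\sigma_j$ and $ds_{j,k}(x)=\widehat{s}_{j+1,k}(x)\,d\sigma_j(x)$ for $1\le j<k\le m$. Assume that $\sigma_1,\dots,\sigma_m$ generate a Nikishin system: for $1\le j<m$ the intervals $\Delta_j$ and $\Delta_{j+1}$ have at most one common point, such a point is not a mass point of $\sigma_j$ or of $\sigma_{j+1}$, and $\widehat{s}_{j+1,k}\in L_1(\sigma_j)$ for $1\le j<k\le m$. For an integer $n\ge 1$, let $(a_{n,0},\dots,a_{n,m})$ be multi-level Hermite–Padé polynomials, i.e. complex polynomials, not all identically zero, with $\deg a_{n,j}\le n-1$ for $0\le j\le m-1$ and $\deg a_{n,m}\le n$,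 such that the forms $$\mathcal{A}_{n,j}=(-1)^ja_{n,j}+\sum_{k=j+1}^m(-1)^ka_{n,k}\,\widehat{s}_{j+1,k}\quad(0\le j\le m-1),\qquad \mathcal{A}_{n,m}=a_{n,m},$$ satisfy $\mathcal{A}_{n,0}(z)=\mathcal{O}(1/z^{n+1})$ and $\mathcal{A}_{n,j}(z)=\mathcal{O}(1/z)$ for $1\le j\le m-1$. Here and below, $\mathcal{O}$ and the asymptotic expansions of $\mathcal{A}_{n,j}$ in powers of $1/z$ are taken as $z\to\infty$ non-tangentially to $\Delta_{j+1}$, that is, with $\mathrm{dist}(z,\Delta_{j+1})\ge\delta|z|$, for every $\delta>0$. Then: (a) $\mathcal{A}_{n,0}$ has no zero in $\mathbb{C}\setminus\Delta_1$, and the coefficient of $1/z^{n+1}$ in its asymptotic expansion at $\infty$ is different from zero. (b) For $j=1,\dots,m$, $\mathcal{A}_{n,j}$ has exactly $n$ zeros in $\mathbb{C}\setminus\Delta_{j+1}$; they are all simple and lie in $\overset{\circ}{\Delta}_j$. For $j=1,\dots,m-1$, the coefficient of $1/z$ in the asymptotic expansion of $\mathcal{A}_{n,j}$ at $\infty$ is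 different from zero. In particular, the multi-index $(n,\dots,n,n+1)$ is normal: every vector $(a_{n,0},\dots,a_{n,m})$ of multi-level Hermite–Padé polynomials satisfies $\deg a_{n,j}=n-1$ for $0\le j\le m-1$ and $\deg a_{n,m}=n$. -/

import Mathlib

open Filter Topology MeasureTheory Polynomial

namespace Nikishin

/-- The (real, possibly signed) Borel measure on the line with density `dens` with respect to the
positive measure `base`. Densities are typed as complex-valued because they arise as restrictions
to the real line of Cauchy transforms. -/
structure WMeasure where
  base : Measure ℝ
  dens : ℝ → ℂ

/-- The Cauchy transform `z ↦ ∫ ds(x) / (z - x)`. -/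
noncomputable def cauchy (s : WMeasure) (z : ℂ) : ℂ :=
  ∫ x, s.dens x / (z - (x : ℂ)) ∂s.base

/-- The product `⟨α, β⟩`, that is, `d⟨α, β⟩(x) = (cauchy β)(x) dα(x)`. -/
noncomputable def angle (α β : WMeasure) : WMeasure where
  base := α.base
  dens := fun x => cauchy β (x : ℂ) * α.dens x

/-- The `j`-th generating measure, of constant sign: `σ_j = ε_j μ_j` with `ε_j ∈ {1, -1}` and `μ_j`
a positive measure. -/
noncomputable def gen (ε : ℕ → ℤˣ) (μ : ℕ → Measure ℝ) (j : ℕ) : WMeasure where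
  base := μ j
  dens := fun _ => ((ε j : ℤ) : ℂ)

/-- `chain ε μ j d` is `⟨σ_j, ⟨σ_{j+1}, …, σ_{j+d}⟩⟩`. -/
noncomputable def chain (ε : ℕ → ℤˣ) (μ : ℕ → Measure ℝ) : ℕ → ℕ → WMeasure
  | j, 0 => gen ε μ j
  | j, d + 1 => angle (gen ε μ j) (chain ε μ (j + 1) d)

/-- The measure `s_{j,k} = ⟨σ_j, …, σ_k⟩`, for `j ≤ k`. -/
noncomputable def s (ε : ℕ → ℤˣ) (μ : ℕ → Measure ℝ) (j k : ℕ) : WMeasure :=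
  chain ε μ j (k - j)

/-- `Δ_j = Co (supp σ_j)` for `1 ≤ j ≤ m`, and `Δ_j = ∅` for other `j`, in particular
for `j = m + 1`. -/
noncomputable def Δ (m : ℕ) (μ : ℕ → Measure ℝ) (j : ℕ) : Set ℝ :=
  if 1 ≤ j ∧ j ≤ m then convexHull ℝ (μ j).support else ∅

/-- The measures `σ_j = ε_j μ_j`, `1 ≤ j ≤ m`, generate a Nikishin system `𝒩(σ_1, …, σ_m)`. -/
structure IsNikishinSystem (m : ℕ) (ε : ℕ → ℤˣ) (μ : ℕ → Measure ℝ) : Prop where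
  /-- each support has infinitely many points -/
  support_infinite : ∀ j, 1 ≤ j → j ≤ m → (μ j).support.Infinite
  /-- all moments are finite (the zeroth one says that the measure is finite) -/
  moments : ∀ j, 1 ≤ j → j ≤ m → ∀ ν : ℕ, Integrable (fun x : ℝ => x ^ ν) (μ j)
  /-- consecutive intervals have at most one common point -/
  inter : ∀ j, 1 ≤ j → j + 1 ≤ m → (Δ m μ j ∩ Δ m μ (j + 1)).Subsingleton
  /-- a common point carries no mass -/
  no_mass : ∀ j, 1 ≤ j → j + 1 ≤ m → ∀ x ∈ Δ m μ j ∩ Δ m μ (j + 1),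
    μ j {x} = 0 ∧ μ (j + 1) {x} = 0
  /-- the Cauchy transform of `s_{j+1,k}` belongs to `L¹(σ_j)`, so that `s_{j,k}` is defined -/
  integrable : ∀ j k, 1 ≤ j → j < k → k ≤ m →
    Integrable (fun x : ℝ => cauchy (s ε μ (j + 1) k) (x : ℂ)) (μ j)

/-- A set of reals, seen inside the complex plane. -/
def toPlane (E : Set ℝ) : Set ℂ := (fun x : ℝ => (x : ℂ)) '' E

/-- `z → ∞` inside the region `δ |z| ≤ dist(z, E)`. As `δ > 0` varies, these are the approaches to
`∞` that are not tangential to `E`; if `E` is bounded and `δ < 1`, the region contains all `z` of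
large modulus. -/
noncomputable def nonTangential (E : Set ℝ) (δ : ℝ) : Filter ℂ :=
  Bornology.cobounded ℂ ⊓ 𝓟 {z : ℂ | δ * ‖z‖ ≤ Metric.infDist z (toPlane E)}

/-- `f(z) = 𝒪(1 / z ^ N)` as `z → ∞` non-tangentially to `E`. -/
def IsBigOInfty (E : Set ℝ) (f : ℂ → ℂ) (N : ℕ) : Prop :=
  ∀ δ : ℝ, 0 < δ → f =O[nonTangential E δ] (fun z : ℂ => 1 / z ^ N)

/-- `f(z) ∼ ∑_{i ≥ 0} c_i / z ^ (i + 1)` as `z → ∞` non-tangentially to `E`. -/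
def HasExpansion (E : Set ℝ) (f : ℂ → ℂ) (c : ℕ → ℂ) : Prop :=
  ∀ δ : ℝ, 0 < δ → ∀ k : ℕ,
    Tendsto (fun z : ℂ => z ^ (k + 1) * (f z - ∑ i ∈ Finset.range k, c i / z ^ (i + 1)))
      (nonTangential E δ) (𝓝 (c k))

/-- The forms
`𝒜_j = (-1)^j a_j + ∑_{k=j+1}^m (-1)^k a_k ŝ_{j+1,k}` for `j < m`, and `𝒜_m = a_m`. -/
noncomputable def form (m : ℕ) (ε : ℕ → ℤˣ) (μ : ℕ → Measure ℝ) (a : ℕ → ℂ[X]) (j : ℕ)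
    (z : ℂ) : ℂ :=
  if j = m then (a m).eval z
  else (-1) ^ j * (a j).eval z +
    ∑ k ∈ Finset.Icc (j + 1) m, (-1) ^ k * (a k).eval z * cauchy (s ε μ (j + 1) k) z

/-- The multi-index `(n, …, n, n + 1)`, with entries numbered from `0` to `m`. -/
def multiIndex (m n j : ℕ) : ℕ := if j = m then n + 1 else n

/-- `(a_0, …, a_m)` is a vector of multi-level Hermite–Padé polynomials: the degrees are at most
`n - 1` for `j < m` and at most `n` for `j = m`, not all the polynomials vanish, and the
interpolation conditions at infinity hold. -/
structure IsMLHermitePade (m : ℕ) (ε : ℕ → ℤˣ) (μ : ℕ → Measure ℝ) (n : ℕ)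
    (a : ℕ → ℂ[X]) : Prop where
  degree_lt : ∀ j, j ≤ m → (a j).degree < (multiIndex m n j : WithBot ℕ)
  ne_zero : ∃ j, j ≤ m ∧ a j ≠ 0
  form_zero : IsBigOInfty (Δ m μ 1) (form m ε μ a 0) (n + 1)
  form_pos : ∀ j, 1 ≤ j → j + 1 ≤ m → IsBigOInfty (Δ m μ (j + 1)) (form m ε μ a j) 1

/-- Normality of the multi-index `(n, …, n, n + 1)`: in every solution, all the polynomials have
the largest degree that is allowed. -/
def IsNormalIndex (m : ℕ) (ε : ℕ → ℤˣ) (μ : ℕ → Measure ℝ) (n : ℕ) : Prop :=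
  ∀ a : ℕ → ℂ[X], IsMLHermitePade m ε μ n a →
    ∀ j, j ≤ m → (a j).degree + 1 = (multiIndex m n j : WithBot ℕ)

end Nikishin

namespace Nikishin

/-! ### Sign changes and zeros of real functions -/

/-! The forms are nested Cauchy transforms. Moving the polynomials `a k` under the integrals shows
that `𝒜_j` differs from the transform of `𝒜_{j+1} dσ_{j+1}` by a polynomial (up to the sign
convention for `𝒜_m`), and decay at infinity makes that polynomial zero: this is
`IsMLHermitePade.isChain`. The order `n + 1` of `𝒜_0` at infinity then says that the first `n`
moments of `𝒜_1 dσ_1` vanish (`IsMLHermitePade.isOrthogonal`).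

Suppose the forms are real on the line. If `f_j dσ_j / Q` annihilates all polynomials of degree
below `N`, then `f_j` has `N` zeros inside `Δ_j` (`IsOrthogonal.le_encard`). These zeros lie off
`Δ_{j+1}`, where `f_j` is a transform of `f_{j+1}`, so dividing by the polynomial with these zeros
gives `N` relations for `f_{j+1}` (`IsOrthogonal.mul_prod`). Repeating this down to the last
function, a polynomial of degree at most `n`, yields `N ≤ n` (`IsChain.le_natDegree`). A zero of
`𝒜_0`, an additional or double zero of `𝒜_j` for `0 < j < m`, or a vanishing coefficient at infinity
would each produce an `(n + 1)`-st relation; for `𝒜_m` the degree itself bounds the zeros.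

Reality comes from the same count. All measures are real, so conjugates and linear combinations of
chains are chains. Real and imaginary parts then show that a last polynomial of degree below `n` is
zero (`IsChain.eq_zero_of_degree_lt`). Thus `a_m` has degree `n`, and once its leading coefficient
is made real, its difference from its conjugate has degree below `n` and vanishes
(`IsMLHermitePade.exists_real`).

For the other degrees, the coefficient of `z^(n-1)` in `𝒜_j` involves only `a_j` and `a_m`, the
latter weighted by the total mass of `s_{j+1,m}`. That mass is nonzero by the same count for a chain
ending in the constant `1` (`integral_dens_ne_zero`). -/

theorem pos_or_neg_of_ne_zero {U : Set ℝ} (hU : IsPreconnected U) {G : ℝ → ℝ}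
    (hG : ContinuousOn G U) (h0 : ∀ x ∈ U, G x ≠ 0) :
    (∀ x ∈ U, 0 < G x) ∨ (∀ x ∈ U, G x < 0) := by
  by_contra! h
  obtain ⟨⟨a, ha, ha'⟩, b, hb, hb'⟩ := h
  obtain ⟨c, hc, hc'⟩ := hU.intermediate_value ha hb hG ⟨ha', hb'⟩
  exact h0 c hc hc'

/-- A continuous function with finitely many zeros on an interval becomes nonnegative after
multiplication by a polynomial whose degree is at most the number of zeros. -/
theorem exists_polynomial_mul_nonneg {G : ℝ → ℝ} (Z : Finset ℝ) :
    ∀ U : Set ℝ, U.OrdConnected → ContinuousOn G U → (∀ x ∈ U, G x = 0 ↔ x ∈ Z) →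
      ∃ p : ℝ[X], p.natDegree ≤ Z.card ∧ (∀ x, p.eval x = 0 → x ∈ Z) ∧
        ∀ x ∈ U, 0 ≤ p.eval x * G x := by
  induction Z using Finset.induction_on_max with
  | empty =>
    intro U hU hG h0
    rcases pos_or_neg_of_ne_zero hU.isPreconnected hG (fun x hx => by simp [h0 x hx]) with h | h
    · exact ⟨1, by simp, by simp, fun x hx => by simpa using (h x hx).le⟩
    · exact ⟨-1, by simp, by simp, fun x hx => by simpa using (h x hx).le⟩
  | insert a Z hZ ih =>
    intro U hU hG h0
    have haZ : a ∉ Z := fun h => lt_irrefl _ (hZ a h)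
    obtain ⟨p, hpd, hp0, hp⟩ := ih (U ∩ Set.Iio a) (hU.inter Set.ordConnected_Iio)
      (hG.mono Set.inter_subset_left) (fun x hx => by
        rw [h0 x hx.1, Finset.mem_insert, or_iff_right (ne_of_lt hx.2)])
    have hright := pos_or_neg_of_ne_zero (G := fun x => p.eval x * G x)
      (hU.inter (Set.ordConnected_Ioi (a := a))).isPreconnected
      ((p.continuous.continuousOn).mul (hG.mono Set.inter_subset_left)) (fun x hx => by
        have hxa : a < x := hx.2
        refine mul_ne_zero (fun h => ?_) (fun h => ?_)
        · exact absurd (hZ x (hp0 x h)) hxa.not_gt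
        · rcases Finset.mem_insert.1 ((h0 x hx.1).1 h) with h | h
          · exact hxa.ne' h
          · exact absurd (hZ x h) hxa.not_gt)
    -- Left of the largest zero `a` the product is already nonnegative. The factor `a - x`, positive
    -- there, is added only when the sign to the right of `a` is wrong.
    rcases hright with h | h
    · refine ⟨p, hpd.trans (Finset.card_le_card (Finset.subset_insert _ _)),
        fun x hx => Finset.mem_insert_of_mem (hp0 x hx), fun x hx => ?_⟩
      rcases lt_trichotomy x a with hxa | rfl | hxa
      · exact hp x ⟨hx, hxa⟩
      · simp [(h0 x hx).2 (Finset.mem_insert_self _ _)]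
      · exact (h x ⟨hx, hxa⟩).le
    · refine ⟨p * (C a - X), ?_, fun x hx => ?_, fun x hx => ?_⟩
      · rw [Finset.card_insert_of_notMem haZ]
        refine natDegree_mul_le.trans (add_le_add hpd ?_)
        exact (natDegree_sub_le _ _).trans (by simp)
      · simp only [eval_mul, eval_sub, eval_C, eval_X, mul_eq_zero, sub_eq_zero] at hx
        rcases hx with hx | hx
        · exact Finset.mem_insert_of_mem (hp0 x hx)
        · exact Finset.mem_insert.2 (Or.inl hx.symm)
      · have e : (p * (C a - X)).eval x * G x = (p.eval x * G x) * (a - x) := by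
          simp only [eval_mul, eval_sub, eval_C, eval_X]; ring
        rw [e]
        rcases lt_trichotomy x a with hxa | rfl | hxa
        · exact mul_nonneg (hp x ⟨hx, hxa⟩) (sub_nonneg.2 hxa.le)
        · simp
        · exact mul_nonneg_of_nonpos_of_nonpos (h x ⟨hx, hxa⟩).le (sub_nonpos.2 hxa.le)

/-! ### Intervals of the real line -/

theorem exists_lt_lt_of_infinite {T : Set ℝ} (hT : T.Infinite) :
    ∃ a ∈ T, ∃ b ∈ T, ∃ c ∈ T, a < b ∧ b < c := by
  obtain ⟨F, hF, hc⟩ := hT.exists_subset_card_eq 3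
  let e := F.orderEmbOfFin hc
  have he : ∀ i, e i ∈ T := fun i => hF (F.orderEmbOfFin_mem hc i)
  exact ⟨e 0, he 0, e 1, he 1, e 2, he 2, e.strictMono (by decide), e.strictMono (by decide)⟩

/-- Of three points in a convex set of reals, the middle one is interior. Applied to a support with
finitely many points removed, this gives interior support points away from the zeros of a function.
-/
theorem exists_mem_interior_of_infinite {T D : Set ℝ} (hD : Convex ℝ D) (hT : T.Infinite)
    (hTD : T ⊆ D) : ∃ b ∈ T, b ∈ interior D := by
  obtain ⟨a, ha, b, hb, c, hc, hab, hbc⟩ := exists_lt_lt_of_infinite hT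
  refine ⟨b, hb, mem_interior.2 ⟨Set.Ioo a c, ?_, isOpen_Ioo, hab, hbc⟩⟩
  exact Set.Ioo_subset_Icc_self.trans (hD.ordConnected.out (hTD ha) (hTD hc))

/-- The convex hull of a closed set of reals is closed. -/
theorem isClosed_convexHull_real {S : Set ℝ} (hS : IsClosed S) : IsClosed (convexHull ℝ S) := by
  rw [← closure_subset_iff_isClosed]
  intro x hx
  by_contra hxS
  have hx' : x ∉ S := fun h => hxS (subset_convexHull ℝ S h)
  obtain ⟨r, hr, hball⟩ := Metric.isOpen_iff.1 hS.isOpen_compl x hx'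
  have hfar : ∀ y ∈ S, y ≤ x - r ∨ x + r ≤ y := by
    intro y hy
    by_contra! h
    exact hball (by rw [Metric.mem_ball, Real.dist_eq, abs_lt]; constructor <;> linarith) hy
  -- Points of `S` on both sides of the gap around `x` would put `x` in the convex hull.
  have key : (∀ y ∈ S, y ≤ x - r) ∨ (∀ y ∈ S, x + r ≤ y) := by
    by_contra! h
    obtain ⟨⟨y, hy, hy'⟩, z, hz, hz'⟩ := h
    have h1 := (hfar y hy).resolve_left (not_le.2 hy')
    have h2 := (hfar z hz).resolve_right (not_le.2 hz')
    exact hxS ((convex_convexHull ℝ S).ordConnected.out (subset_convexHull ℝ S hz)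
      (subset_convexHull ℝ S hy) ⟨by linarith, by linarith⟩)
  rcases key with h | h
  · have h' := closure_minimal (convexHull_min h (convex_Iic (x - r))) isClosed_Iic hx
    linarith [Set.mem_Iic.1 h']
  · have h' := closure_minimal (convexHull_min h (convex_Ici (x + r))) isClosed_Ici hx
    linarith [Set.mem_Ici.1 h']

/-- Two intervals with at most one common point lie on the two sides of a point. -/
theorem exists_separation {A B : Set ℝ} (hA : Convex ℝ A) (hB : Convex ℝ B)
    (hA' : (interior A).Nonempty) (hB' : (interior B).Nonempty)
    (hdisj : Disjoint (interior A) B) :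
    ∃ c : ℝ, ∀ x ∈ A, ∀ y ∈ B, |x - c| ≤ |x - y| := by
  obtain ⟨f, u, hf, hf'⟩ := geometric_hahn_banach_open_open hA.interior isOpen_interior
    hB.interior isOpen_interior (hdisj.mono_right interior_subset)
  have hf1 : ∀ x : ℝ, f x = x * f 1 := fun x => by
    conv_lhs => rw [← mul_one x, ← smul_eq_mul, map_smul, smul_eq_mul]
  have h0 : f 1 ≠ 0 := by
    intro h
    obtain ⟨a, ha⟩ := hA'
    obtain ⟨b, hb⟩ := hB'
    have h1 := hf a ha
    have h2 := hf' b hb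
    rw [hf1, h] at h1 h2
    linarith
  have hfA : ∀ x ∈ A, f x ≤ u := by
    intro x hx
    have hcl := (hA.closure_interior_eq_closure_of_nonempty_interior hA').ge (subset_closure hx)
    exact closure_minimal (t := {x | f x ≤ u}) (fun y hy => (hf y hy).le)
      (isClosed_le f.continuous continuous_const) hcl
  have hfB : ∀ x ∈ B, u ≤ f x := by
    intro x hx
    have hcl := (hB.closure_interior_eq_closure_of_nonempty_interior hB').ge (subset_closure hx)
    exact closure_minimal (t := {x | u ≤ f x}) (fun y hy => (hf' y hy).le)
      (isClosed_le continuous_const f.continuous) hcl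
  -- A linear functional on the line is multiplication by `f 1`, so the separating level `u` is
  -- reached exactly at `u / f 1`.
  refine ⟨u / f 1, fun x hx y hy => ?_⟩
  have h1 := hfA x hx
  have h2 := hfB y hy
  rw [hf1] at h1 h2
  have hu : u = u / f 1 * f 1 := by field_simp
  rw [hu] at h1 h2
  set c := u / f 1
  rcases lt_or_gt_of_ne h0 with h | h
  · have h3 : c ≤ x := by nlinarith
    have h4 : y ≤ c := by nlinarith
    rw [abs_of_nonneg (by linarith), abs_of_nonneg (by linarith)]; linarith
  · have h3 : x ≤ c := by nlinarith
    have h4 : c ≤ y := by nlinarith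
    rw [abs_of_nonpos (by linarith), abs_of_nonpos (by linarith)]; linarith

/-! ### Cauchy transforms -/

theorem isClosed_toPlane {D : Set ℝ} (hD : IsClosed D) : IsClosed (toPlane D) :=
  Complex.isometry_ofReal.isClosedEmbedding.isClosedMap D hD

theorem ofReal_mem_toPlane {D : Set ℝ} {x : ℝ} : (x : ℂ) ∈ toPlane D ↔ x ∈ D := by
  simp [toPlane]

theorem conj_mem_toPlane {D : Set ℝ} {z : ℂ} : starRingEnd ℂ z ∈ toPlane D ↔ z ∈ toPlane D := by
  constructor
  · rintro ⟨x, hx, h⟩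
    exact ⟨x, hx, by simpa using congrArg (starRingEnd ℂ) h⟩
  · rintro ⟨x, hx, rfl⟩
    exact ⟨x, hx, by simp⟩

theorem sub_ne_zero_of_notMem {D : Set ℝ} {z : ℂ} (hz : z ∉ toPlane D) {x : ℝ} (hx : x ∈ D) :
    z - x ≠ 0 :=
  fun h => hz ⟨x, hx, (sub_eq_zero.1 h).symm⟩

/-- One lower bound serves for a whole ball around `z`, as needed to dominate the difference
quotients when differentiating under the integral. -/
theorem exists_pos_le_norm_sub {D : Set ℝ} (hD : IsClosed D) {z : ℂ} (hz : z ∉ toPlane D) :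
    ∃ d > 0, ∀ w ∈ Metric.ball z d, ∀ x ∈ D, d ≤ ‖w - x‖ := by
  obtain ⟨r, hr, hball⟩ := Metric.isOpen_iff.1 (isClosed_toPlane hD).isOpen_compl z hz
  refine ⟨r / 2, by positivity, fun w hw x hx => ?_⟩
  by_contra! h
  have hmem : (x : ℂ) ∈ Metric.ball z r → False := fun h' => hball h' ⟨x, hx, rfl⟩
  refine hmem ?_
  rw [Metric.mem_ball] at hw ⊢
  rw [← dist_eq_norm, dist_comm] at h
  linarith [dist_triangle (x : ℂ) w z]

variable {μ : Measure ℝ} {φ : ℝ → ℂ} {D : Set ℝ}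

theorem aestronglyMeasurable_div (hφ : AEStronglyMeasurable φ μ) (z : ℂ) :
    AEStronglyMeasurable (fun x : ℝ => φ x / (z - x)) μ := by
  simp only [div_eq_mul_inv]
  have : Measurable (fun x : ℝ => (z - (x : ℂ))⁻¹) := by fun_prop
  exact hφ.mul this.aestronglyMeasurable

theorem integrable_div_of_le (hD : ∀ᵐ x ∂μ, x ∈ D) (hφ : Integrable φ μ) {z : ℂ} {d : ℝ}
    (hd : 0 < d) (h : ∀ x ∈ D, d ≤ ‖z - x‖) : Integrable (fun x : ℝ => φ x / (z - x)) μ := by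
  refine (hφ.norm.div_const d).mono' (aestronglyMeasurable_div hφ.1 z) ?_
  filter_upwards [hD] with x hx
  rw [norm_div]
  exact div_le_div_of_nonneg_left (norm_nonneg _) hd (h x hx)

theorem norm_integral_div_le (hD : ∀ᵐ x ∂μ, x ∈ D) (hφ : Integrable φ μ) {z : ℂ} {d : ℝ}
    (hd : 0 < d) (h : ∀ x ∈ D, d ≤ ‖z - x‖) :
    ‖∫ x, φ x / (z - x) ∂μ‖ ≤ (∫ x, ‖φ x‖ ∂μ) / d := by
  rw [← integral_div]
  refine norm_integral_le_of_norm_le (hφ.norm.div_const d) ?_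
  filter_upwards [hD] with x hx
  rw [norm_div]
  exact div_le_div_of_nonneg_left (norm_nonneg _) hd (h x hx)

theorem integrable_div (hDc : IsClosed D) (hD : ∀ᵐ x ∂μ, x ∈ D) (hφ : Integrable φ μ) {z : ℂ}
    (hz : z ∉ toPlane D) : Integrable (fun x : ℝ => φ x / (z - x)) μ := by
  obtain ⟨d, hd, h⟩ := exists_pos_le_norm_sub hDc hz
  exact integrable_div_of_le hD hφ hd (h z (Metric.mem_ball_self hd))

theorem hasDerivAt_integral_div (hDc : IsClosed D) (hD : ∀ᵐ x ∂μ, x ∈ D) (hφ : Integrable φ μ)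
    {z : ℂ} (hz : z ∉ toPlane D) :
    HasDerivAt (fun z : ℂ => ∫ x, φ x / (z - x) ∂μ) (∫ x, -(φ x / (z - x) ^ 2) ∂μ) z := by
  obtain ⟨d, hd, h⟩ := exists_pos_le_norm_sub hDc hz
  refine (hasDerivAt_integral_of_dominated_loc_of_deriv_le (𝕜 := ℂ)
    (F := fun z x => φ x / (z - x)) (F' := fun z x => -(φ x / (z - x) ^ 2))
    (bound := fun x => ‖φ x‖ / d ^ 2) (Metric.ball_mem_nhds z hd)
    (Eventually.of_forall fun w => aestronglyMeasurable_div hφ.1 w)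
    (integrable_div hDc hD hφ hz) ?_ ?_ (hφ.norm.div_const _) ?_).2
  · have := (aestronglyMeasurable_div (aestronglyMeasurable_div hφ.1 z) z).neg
    refine this.congr (Eventually.of_forall fun x => ?_)
    simp [div_div, sq]
  · filter_upwards [hD] with x hx w hw
    rw [norm_neg, norm_div, norm_pow]
    exact div_le_div_of_nonneg_left (norm_nonneg _) (by positivity)
      (pow_le_pow_left₀ hd.le (h w hw x hx) 2)
  · filter_upwards [hD] with x hx w hw
    have hne : w - x ≠ 0 := norm_pos_iff.1 (hd.trans_le (h w hw x hx))
    have := (((hasDerivAt_id w).sub_const (x : ℂ)).inv hne).const_mul (φ x)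
    refine (this.congr_deriv ?_).congr_of_eventuallyEq (Eventually.of_forall fun y => ?_)
    · simp only [id]; ring
    · simp [div_eq_mul_inv]

theorem integral_conj_div (hφ : ∀ᵐ x ∂μ, starRingEnd ℂ (φ x) = φ x) (z : ℂ) :
    ∫ x, φ x / (starRingEnd ℂ z - x) ∂μ = starRingEnd ℂ (∫ x, φ x / (z - x) ∂μ) := by
  rw [← integral_conj]
  refine integral_congr_ae ?_
  filter_upwards [hφ] with x hx
  simp [hx]

/-! ### Measures with finite moments -/

theorem integrable_eval_mul (hφ : ∀ ν : ℕ, Integrable (fun x : ℝ => (x : ℂ) ^ ν * φ x) μ)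
    (p : ℂ[X]) : Integrable (fun x : ℝ => p.eval (x : ℂ) * φ x) μ := by
  induction p using Polynomial.induction_on' with
  | add p q hp hq =>
    simp only [eval_add, add_mul]
    exact hp.add hq
  | monomial n c => simpa [mul_assoc] using (hφ n).const_mul c

/-- The quotient `(p(z) - p(x)) / (z - x)` is a polynomial in both variables, and integrating in `x`
turns it into a polynomial in `z` with moments in its coefficients. The induction on monomials uses
`x / (z - x) = z / (z - x) - 1`. -/
theorem eval_mul_integral_div (hDc : IsClosed D) (hD : ∀ᵐ x ∂μ, x ∈ D)
    (hφ : ∀ ν : ℕ, Integrable (fun x : ℝ => (x : ℂ) ^ ν * φ x) μ) (p : ℂ[X]) :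
    ∃ q : ℂ[X], ∀ z ∉ toPlane D, p.eval z * ∫ x, φ x / (z - x) ∂μ =
      q.eval z + ∫ x, p.eval (x : ℂ) * φ x / (z - x) ∂μ := by
  induction p using Polynomial.induction_on with
  | C a =>
    refine ⟨0, fun z _ => ?_⟩
    simp [mul_div_assoc, integral_const_mul]
  | add p q hp hq =>
    obtain ⟨p', hp⟩ := hp
    obtain ⟨q', hq⟩ := hq
    refine ⟨p' + q', fun z hz => ?_⟩
    simp only [eval_add, add_mul, add_div]
    rw [hp z hz, hq z hz, integral_add (integrable_div hDc hD (integrable_eval_mul hφ p) hz)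
      (integrable_div hDc hD (integrable_eval_mul hφ q) hz)]
    ring
  | monomial n c ih =>
    obtain ⟨q, hq⟩ := ih
    refine ⟨q * X + C (∫ x, (C c * X ^ n).eval ((x : ℝ) : ℂ) * φ x ∂μ), fun z hz => ?_⟩
    have e : ∫ x, (C c * X ^ (n + 1)).eval ((x : ℝ) : ℂ) * φ x / (z - x) ∂μ =
        z * (∫ x, (C c * X ^ n).eval ((x : ℝ) : ℂ) * φ x / (z - x) ∂μ) -
          ∫ x, (C c * X ^ n).eval ((x : ℝ) : ℂ) * φ x ∂μ := by
      rw [← integral_const_mul, ← integral_sub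
        ((integrable_div hDc hD (integrable_eval_mul hφ _) hz).const_mul z)
        (integrable_eval_mul hφ _)]
      refine integral_congr_ae ?_
      filter_upwards [hD] with x hx
      have := sub_ne_zero_of_notMem hz hx
      simp only [eval_mul, eval_C, eval_pow, eval_X]
      field_simp
      ring
    rw [e]
    have := hq z hz
    simp only [eval_mul, eval_C, eval_pow, eval_X, eval_add] at this ⊢
    linear_combination z * this

/-! ### Behaviour at infinity -/

theorem nonTangential_eventually {E : Set ℝ} {δ : ℝ} :
    ∀ᶠ z in nonTangential E δ, z ≠ 0 ∧ ∀ x ∈ E, δ * ‖z‖ ≤ ‖z - (x : ℂ)‖ := by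
  have h1 : ∀ᶠ z in nonTangential E δ, z ≠ 0 :=
    (show nonTangential E δ ≤ Bornology.cobounded ℂ from inf_le_left)
      (Bornology.isBounded_singleton (x := (0 : ℂ)))
  have h2 : ∀ᶠ z in nonTangential E δ, δ * ‖z‖ ≤ Metric.infDist z (toPlane E) :=
    (show nonTangential E δ ≤ _ from inf_le_right) (mem_principal_self _)
  filter_upwards [h1, h2] with z hz hz'
  refine ⟨hz, fun x hx => hz'.trans ?_⟩
  rw [← dist_eq_norm]
  exact Metric.infDist_le_dist_of_mem ⟨x, hx, rfl⟩

theorem nonTangential_notMem {E : Set ℝ} {δ : ℝ} (hδ : 0 < δ) :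
    ∀ᶠ z in nonTangential E δ, z ∉ toPlane E := by
  filter_upwards [nonTangential_eventually] with z hz
  rintro ⟨x, hx, rfl⟩
  have h := hz.2 x hx
  rw [sub_self, norm_zero] at h
  have := mul_pos hδ (norm_pos_iff.2 hz.1)
  linarith

theorem tendsto_norm_nonTangential {E : Set ℝ} {δ : ℝ} :
    Tendsto (fun z : ℂ => ‖z‖) (nonTangential E δ) atTop :=
  tendsto_norm_cobounded_atTop.mono_left inf_le_left

theorem tendsto_inv_nonTangential {E : Set ℝ} {δ : ℝ} :
    Tendsto (fun z : ℂ => z⁻¹) (nonTangential E δ) (𝓝 0) := by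
  rw [tendsto_zero_iff_norm_tendsto_zero]
  simpa only [norm_inv, Function.comp_def] using
    tendsto_inv_atTop_zero.comp (tendsto_norm_nonTangential (E := E) (δ := δ))

/-- The points `iy`, `y ≥ 0`, are at distance at least `y` from the real line, so the imaginary
half-axis stays in the region for `δ = 1`. Limits along this filter are therefore unique.
Nonemptiness matters because `Metric.infDist` to the empty set is `0`. -/
theorem nonTangential_neBot {E : Set ℝ} (hE : E.Nonempty) : (nonTangential E 1).NeBot := by
  have : Tendsto (fun y : ℝ => (y : ℂ) * Complex.I) atTop (nonTangential E 1) := by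
    refine tendsto_inf.2 ⟨?_, tendsto_principal.2 ?_⟩
    · rw [← tendsto_norm_atTop_iff_cobounded]
      simpa using tendsto_abs_atTop_atTop
    · filter_upwards [eventually_ge_atTop 0] with y hy
      refine (Metric.le_infDist (hE.image _)).2 ?_
      rintro _ ⟨x, _, rfl⟩
      rw [dist_eq_norm, one_mul]
      refine le_trans ?_ (Complex.abs_im_le_norm _)
      simp
  exact this.neBot

theorem tendsto_integral_div (hD : ∀ᵐ x ∂μ, x ∈ D) (hφ : Integrable φ μ) {δ : ℝ} (hδ : 0 < δ) :
    Tendsto (fun z : ℂ => ∫ x, φ x / (z - x) ∂μ) (nonTangential D δ) (𝓝 0) := by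
  have h0 : Tendsto (fun z : ℂ => (∫ x, ‖φ x‖ ∂μ) / (δ * ‖z‖)) (nonTangential D δ) (𝓝 0) :=
    (tendsto_norm_nonTangential.const_mul_atTop hδ).const_div_atTop _
  refine squeeze_zero_norm' ?_ h0
  filter_upwards [nonTangential_eventually] with z hz
  exact norm_integral_div_le hD hφ (mul_pos hδ (norm_pos_iff.2 hz.1)) hz.2

/-- Iterating `x / (z - x) = z / (z - x) - 1` extracts one moment at a time. The remainder is again
a Cauchy transform, so it tends to zero at infinity. -/
theorem integral_div_sub_sum (hDc : IsClosed D) (hD : ∀ᵐ x ∂μ, x ∈ D)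
    (hφ : ∀ ν : ℕ, Integrable (fun x : ℝ => (x : ℂ) ^ ν * φ x) μ) {z : ℂ} (hz : z ∉ toPlane D)
    (hz0 : z ≠ 0) (k : ℕ) :
    z ^ k * (∫ x, φ x / (z - x) ∂μ -
      ∑ i ∈ Finset.range k, (∫ x, ((x : ℝ) : ℂ) ^ i * φ x ∂μ) / z ^ (i + 1)) =
      ∫ x, (x : ℂ) ^ k * φ x / (z - x) ∂μ := by
  induction k with
  | zero => simp
  | succ k ih =>
    have e : ∫ x, ((x : ℝ) : ℂ) ^ (k + 1) * φ x / (z - x) ∂μ =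
        z * (∫ x, ((x : ℝ) : ℂ) ^ k * φ x / (z - x) ∂μ) - ∫ x, ((x : ℝ) : ℂ) ^ k * φ x ∂μ := by
      rw [← integral_const_mul, ← integral_sub
        ((integrable_div hDc hD (hφ _) hz).const_mul z) (hφ _)]
      refine integral_congr_ae ?_
      filter_upwards [hD] with x hx
      have := sub_ne_zero_of_notMem hz hx
      field_simp
      ring
    rw [e, ← ih, Finset.sum_range_succ]
    field_simp
    ring

/-- The moments are the coefficients of the expansion of the Cauchy transform at infinity. -/
theorem hasExpansion_integral_div (hDc : IsClosed D) (hD : ∀ᵐ x ∂μ, x ∈ D)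
    (hφ : ∀ ν : ℕ, Integrable (fun x : ℝ => (x : ℂ) ^ ν * φ x) μ) :
    HasExpansion D (fun z => ∫ x, φ x / (z - x) ∂μ) (fun i => ∫ x, (x : ℂ) ^ i * φ x ∂μ) := by
  intro δ hδ k
  have h := (tendsto_integral_div hD (hφ (k + 1)) hδ).add_const (∫ x, (x : ℂ) ^ k * φ x ∂μ)
  rw [zero_add] at h
  refine h.congr' ?_
  filter_upwards [nonTangential_eventually, nonTangential_notMem hδ] with z hz hz'
  rw [← integral_div_sub_sum hDc hD hφ hz' hz.1, Finset.sum_range_succ]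
  have := hz.1
  field_simp
  ring

theorem HasExpansion.congr {E : Set ℝ} {f g : ℂ → ℂ} {c : ℕ → ℂ} (h : HasExpansion E f c)
    (hfg : ∀ z ∉ toPlane E, g z = f z) : HasExpansion E g c := by
  intro δ hδ k
  refine (h δ hδ k).congr' ?_
  filter_upwards [nonTangential_notMem hδ] with z hz
  rw [hfg z hz]

theorem HasExpansion.const_mul {E : Set ℝ} {f : ℂ → ℂ} {c : ℕ → ℂ} (h : HasExpansion E f c)
    (b : ℂ) : HasExpansion E (fun z => b * f z) (fun i => b * c i) := by
  intro δ hδ k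
  refine ((h δ hδ k).const_mul b).congr fun z => ?_
  simp only [mul_div_assoc, ← Finset.mul_sum]
  ring

/-- Once the earlier coefficients vanish, `z^(i+1) f(z)` tends to `c i`, but it is also
`O(z^(i-n))`. -/
theorem HasExpansion.eq_zero_of_isBigO {E : Set ℝ} (hE : E.Nonempty) {f : ℂ → ℂ} {c : ℕ → ℂ}
    (h : HasExpansion E f c) {n : ℕ} (hf : IsBigOInfty E f (n + 1)) : ∀ i < n, c i = 0 := by
  have := nonTangential_neBot hE
  intro i
  induction i using Nat.strong_induction_on with
  | _ i ih =>
    intro hi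
    have h1 := h 1 one_pos i
    have h2 : Tendsto (fun z : ℂ => z ^ (i + 1) * f z) (nonTangential E 1) (𝓝 (c i)) := by
      refine h1.congr fun z => ?_
      rw [Finset.sum_eq_zero (fun k hk => ?_), sub_zero]
      rw [ih k (Finset.mem_range.1 hk) ((Finset.mem_range.1 hk).trans hi), zero_div]
    have h3 : (fun z : ℂ => z ^ (i + 1) * f z) =O[nonTangential E 1]
        fun z => z ^ (i + 1) * (1 / z ^ (n + 1)) :=
      (Asymptotics.isBigO_refl _ _).mul (hf 1 one_pos)
    have h4 : Tendsto (fun z : ℂ => z ^ (i + 1) * (1 / z ^ (n + 1))) (nonTangential E 1)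
        (𝓝 0) := by
      have h5 := (tendsto_inv_nonTangential (E := E) (δ := 1)).pow (n - i)
      rw [zero_pow (by omega)] at h5
      refine h5.congr' ?_
      filter_upwards [nonTangential_eventually] with z hz
      have := hz.1
      rw [show n + 1 = (n - i) + (i + 1) by omega, pow_add, inv_pow]
      field_simp
      ring
    exact tendsto_nhds_unique h2 (h3.trans_tendsto h4)

theorem eq_zero_of_tendsto_eval {E : Set ℝ} (hE : E.Nonempty) {p : ℂ[X]}
    (h : Tendsto (fun z => p.eval z) (nonTangential E 1) (𝓝 0)) : p = 0 := by
  have := nonTangential_neBot hE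
  by_cases hp : p.degree ≤ 0
  · rw [eq_C_of_degree_le_zero hp] at h ⊢
    simp only [eval_C] at h
    rw [tendsto_nhds_unique tendsto_const_nhds h, C_0]
  · have := Polynomial.tendsto_norm_atTop p (not_le.1 hp)
      (tendsto_norm_nonTangential (E := E) (δ := 1))
    exact absurd h.norm (not_tendsto_nhds_of_tendsto_atTop this _)

theorem tendsto_eval_div_pow {E : Set ℝ} {p : ℂ[X]} {n : ℕ} (hp : p.natDegree ≤ n) :
    Tendsto (fun z => p.eval z / z ^ n) (nonTangential E 1) (𝓝 (p.coeff n)) := by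
  have h : Tendsto (fun z : ℂ => ∑ i ∈ Finset.range (n + 1), p.coeff i * (z⁻¹) ^ (n - i))
      (nonTangential E 1) (𝓝 (∑ i ∈ Finset.range (n + 1), p.coeff i * 0 ^ (n - i))) :=
    tendsto_finsetSum _ fun i _ => (tendsto_inv_nonTangential.pow _).const_mul _
  rw [Finset.sum_range_succ, Finset.sum_eq_zero (fun i hi => by
    rw [zero_pow (by have := Finset.mem_range.1 hi; omega), mul_zero])] at h
  simp only [zero_add, Nat.sub_self, pow_zero, mul_one] at h
  refine h.congr' ?_
  filter_upwards [nonTangential_eventually] with z hz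
  rw [eval_eq_sum_range' (Nat.lt_succ_of_le hp), Finset.sum_div]
  refine Finset.sum_congr rfl fun i hi => ?_
  have hi' := Finset.mem_range.1 hi
  have := hz.1
  rw [mul_div_assoc, inv_pow]
  congr 1
  rw [eq_div_iff (pow_ne_zero _ this), show z ^ n = z ^ (n - i) * z ^ i by
    rw [← pow_add]; congr 1; omega]
  field_simp

end Nikishin

namespace Nikishin

/-! ### Orthogonality relations -/

/-- `∫ p φ / Q dμ = 0` for all polynomials `p` of degree less than `N`. -/
def IsOrthogonal (μ : Measure ℝ) (φ : ℝ → ℂ) (Q : ℂ[X]) (N : ℕ) : Prop :=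
  ∀ p : ℂ[X], p.degree < (N : WithBot ℕ) →
    Integrable (fun x : ℝ => p.eval (x : ℂ) * φ x / Q.eval (x : ℂ)) μ ∧
      ∫ x, p.eval ((x : ℝ) : ℂ) * φ x / Q.eval (x : ℂ) ∂μ = 0

variable {μ : Measure ℝ} {φ : ℝ → ℂ} {D : Set ℝ} {Q : ℂ[X]} {N : ℕ}

theorem isOrthogonal_one_zero : IsOrthogonal μ φ 1 0 := by
  intro p hp
  rw [Nat.cast_zero, Nat.WithBot.lt_zero_iff, degree_eq_bot] at hp
  simp [hp]

/-- Raising the order of a factor of the denominator raises the number of relations. -/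
theorem IsOrthogonal.mul_X_sub_C {z₀ : ℂ} {k : ℕ} (h : IsOrthogonal μ φ (Q * (X - C z₀) ^ k) N)
    (hD : ∀ᵐ x ∂μ, x ∈ D) (hQ : Q.degree ≤ N) (hQ0 : Q.eval z₀ ≠ 0)
    (hQD : ∀ x ∈ D, Q.eval (x : ℂ) ≠ 0) (hz₀ : z₀ ∉ toPlane D)
    (hint : Integrable (fun x : ℝ => φ x / ((x : ℂ) - z₀) ^ (k + 1)) μ)
    (hzero : ∫ x, φ x / (((x : ℝ) : ℂ) - z₀) ^ (k + 1) ∂μ = 0) :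
    IsOrthogonal μ φ (Q * (X - C z₀) ^ (k + 1)) (N + 1) := by
  intro p hp
  -- This `c` makes `p - cQ` divisible by `X - z₀`. The quotient `q` is handled by the old
  -- relations, while in the term `cQ` the factor `Q` cancels and leaves the integral that is
  -- assumed to vanish.
  set c := p.eval z₀ / Q.eval z₀ with hc
  have hroot : (p - C c * Q).IsRoot z₀ := by
    simp only [IsRoot.def, eval_sub, eval_mul, eval_C, hc]
    field_simp
    ring
  set q := (p - C c * Q) /ₘ (X - C z₀) with hq
  have hmul : (X - C z₀) * q = p - C c * Q := mul_divByMonic_eq_iff_isRoot.2 hroot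
  have hdeg : q.degree < N := by
    by_cases hq0 : q = 0
    · rw [hq0, degree_zero]; exact WithBot.bot_lt_coe N
    have h1 : ((X - C z₀) * q).degree < ((N + 1 : ℕ) : WithBot ℕ) := by
      rw [hmul]
      refine (degree_sub_le _ _).trans_lt (max_lt hp ?_)
      rw [← smul_eq_C_mul]
      refine ((degree_smul_le _ _).trans hQ).trans_lt ?_
      exact_mod_cast Nat.lt_succ_self N
    rw [degree_mul, degree_X_sub_C, degree_eq_natDegree hq0] at h1
    rw [degree_eq_natDegree hq0]
    norm_cast at h1 ⊢
    omega
  obtain ⟨hi, h0⟩ := h q hdeg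
  have e : (fun x : ℝ => p.eval (x : ℂ) * φ x / (Q * (X - C z₀) ^ (k + 1)).eval (x : ℂ)) =ᵐ[μ]
      fun x : ℝ => c * (φ x / ((x : ℂ) - z₀) ^ (k + 1)) +
        q.eval (x : ℂ) * φ x / (Q * (X - C z₀) ^ k).eval (x : ℂ) := by
    filter_upwards [hD] with x hx
    have h1 := hQD x hx
    have h2 : (x : ℂ) - z₀ ≠ 0 := by
      rw [← neg_ne_zero, neg_sub]; exact sub_ne_zero_of_notMem hz₀ hx
    have h3 := congrArg (eval (x : ℂ)) hmul
    simp only [eval_mul, eval_sub, eval_X, eval_C] at h3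
    have h4 : p.eval (x : ℂ) = c * Q.eval (x : ℂ) + ((x : ℂ) - z₀) * q.eval (x : ℂ) := by
      rw [h3]; ring
    simp only [eval_mul, eval_pow, eval_sub, eval_X, eval_C, h4]
    field_simp
    ring
  refine ⟨((hint.const_mul c).add hi).congr e.symm, ?_⟩
  rw [integral_congr_ae e, integral_add (hint.const_mul c) hi, integral_const_mul, hzero, h0]
  simp

/-- Subtracting a multiple of `Q` lowers a test polynomial to degree below `N`; the subtracted part
contributes only a multiple of `∫ φ`, since `Q` cancels. -/
theorem IsOrthogonal.succ_of_integral_eq_zero (h : IsOrthogonal μ φ Q N) (hQ : Q.Monic)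
    (hQN : Q.natDegree = N) (hQD : ∀ᵐ x : ℝ ∂μ, Q.eval (x : ℂ) ≠ 0) (hint : Integrable φ μ)
    (hzero : ∫ x, φ x ∂μ = 0) : IsOrthogonal μ φ Q (N + 1) := by
  intro p hp
  set c := p.coeff N
  set q := p - C c * Q with hq
  have hdeg : q.degree < N := by
    rw [degree_lt_iff_coeff_zero]
    intro k hk
    rw [hq, coeff_sub, coeff_C_mul]
    rcases hk.eq_or_lt with rfl | hk
    · have : Q.coeff N = 1 := by rw [← hQN]; exact hQ
      rw [this]; simp [c]
    · rw [coeff_eq_zero_of_natDegree_lt (hQN.trans_lt hk),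
        coeff_eq_zero_of_degree_lt (hp.trans_le (by exact_mod_cast hk))]
      simp
  obtain ⟨hi, h0⟩ := h q hdeg
  have e : (fun x : ℝ => p.eval (x : ℂ) * φ x / Q.eval (x : ℂ)) =ᵐ[μ]
      fun x : ℝ => c * φ x + q.eval (x : ℂ) * φ x / Q.eval (x : ℂ) := by
    filter_upwards [hQD] with x hx
    simp only [hq, eval_sub, eval_mul, eval_C]
    field_simp
    ring
  refine ⟨((hint.const_mul c).add hi).congr e.symm, ?_⟩
  rw [integral_congr_ae e, integral_add (hint.const_mul c) hi, integral_const_mul, hzero, h0]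
  simp

theorem integrable_div_sub (hDc : IsClosed D) (hD : ∀ᵐ x ∂μ, x ∈ D) (hφ : Integrable φ μ)
    {z : ℂ} (hz : z ∉ toPlane D) (k : ℕ) :
    Integrable (fun x : ℝ => φ x / ((x : ℂ) - z) ^ k) μ := by
  induction k with
  | zero => simpa using hφ
  | succ k ih =>
    refine (integrable_div hDc hD ih hz).neg.congr (Eventually.of_forall fun x => ?_)
    simp only [Pi.neg_apply]
    rw [← neg_sub (x : ℂ) z, div_neg, neg_neg, div_div, pow_succ]

theorem eval_prod_X_sub_C (T : Finset ℂ) (x : ℂ) :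
    (∏ t ∈ T, (X - C t)).eval x = ∏ t ∈ T, (x - t) := by
  simp [eval_prod]

theorem eval_prod_ne_zero {T : Finset ℂ} (hT : ∀ t ∈ T, t ∉ toPlane D) {x : ℝ} (hx : x ∈ D) :
    (∏ t ∈ T, (X - C t)).eval (x : ℂ) ≠ 0 := by
  rw [eval_prod_X_sub_C]
  exact Finset.prod_ne_zero_iff.2 fun t ht h => hT t ht ⟨x, hx, sub_eq_zero.1 h⟩

theorem integral_div_sub_eq_zero {z : ℂ} (h : ∫ x, φ x / (z - x) ∂μ = 0) :
    ∫ x, φ x / (((x : ℝ) : ℂ) - z) ^ (0 + 1) ∂μ = 0 := by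
  rw [← neg_eq_zero, ← h, ← integral_neg]
  refine integral_congr_ae (Eventually.of_forall fun x => ?_)
  simp only
  rw [zero_add, pow_one, ← neg_sub z (x : ℂ), div_neg, neg_neg]

/-- Dividing by the polynomial that vanishes at given zeros of the Cauchy transform of `φ dμ`
produces orthogonality relations. -/
theorem IsOrthogonal.mul_prod (hDc : IsClosed D) (hD : ∀ᵐ x ∂μ, x ∈ D) (hφ : Integrable φ μ)
    (h : IsOrthogonal μ φ 1 N) (T : Finset ℂ) (hT : ∀ t ∈ T, t ∉ toPlane D)
    (hzero : ∀ t ∈ T, ∫ x, φ x / (t - x) ∂μ = 0) :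
    IsOrthogonal μ φ (∏ t ∈ T, (X - C t)) (N + T.card) := by
  induction T using Finset.induction_on with
  | empty => simpa using h
  | insert a T haT ih =>
    have ih' := ih (fun t ht => hT t (Finset.mem_insert_of_mem ht))
      (fun t ht => hzero t (Finset.mem_insert_of_mem ht))
    have ha := hT a (Finset.mem_insert_self _ _)
    rw [Finset.prod_insert haT, Finset.card_insert_of_notMem haT, mul_comm, ← add_assoc]
    have key := IsOrthogonal.mul_X_sub_C (z₀ := a) (k := 0) (Q := ∏ t ∈ T, (X - C t)) (φ := φ)
      (μ := μ) (N := N + T.card) (by simpa using ih') hD ?_ ?_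
      (fun x hx => eval_prod_ne_zero (fun t ht => hT t (Finset.mem_insert_of_mem ht)) hx) ha
      (integrable_div_sub hDc hD hφ ha 1)
      (integral_div_sub_eq_zero (hzero a (Finset.mem_insert_self _ _)))
    · simpa using key
    · rw [degree_prod]
      simp only [degree_X_sub_C, Finset.sum_const, nsmul_one]
      exact_mod_cast Nat.le_add_left _ _
    · rw [eval_prod_X_sub_C]
      exact Finset.prod_ne_zero_iff.2 fun t ht h => haT (by rwa [sub_eq_zero.1 h])

theorem isOrthogonal_prod (hDc : IsClosed D) (hD : ∀ᵐ x ∂μ, x ∈ D) (hφ : Integrable φ μ)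
    (T : Finset ℂ) (hT : ∀ t ∈ T, t ∉ toPlane D) (hzero : ∀ t ∈ T, ∫ x, φ x / (t - x) ∂μ = 0) :
    IsOrthogonal μ φ (∏ t ∈ T, (X - C t)) T.card := by
  simpa using isOrthogonal_one_zero.mul_prod hDc hD hφ T hT hzero

/-- A double zero of the Cauchy transform gives one more orthogonality relation. -/
theorem isOrthogonal_prod_mul (hDc : IsClosed D) (hD : ∀ᵐ x ∂μ, x ∈ D) (hφ : Integrable φ μ)
    (T : Finset ℂ) (hT : ∀ t ∈ T, t ∉ toPlane D) (hzero : ∀ t ∈ T, ∫ x, φ x / (t - x) ∂μ = 0)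
    {t₀ : ℂ} (ht₀ : t₀ ∈ T) (hdouble : ∫ x, φ x / (t₀ - x) ^ 2 ∂μ = 0) :
    IsOrthogonal μ φ ((∏ t ∈ T, (X - C t)) * (X - C t₀)) (T.card + 1) := by
  have h := isOrthogonal_prod hDc hD hφ T hT hzero
  rw [← Finset.prod_erase_mul _ _ ht₀] at h ⊢
  rw [mul_assoc, ← pow_two]
  refine IsOrthogonal.mul_X_sub_C (k := 1) (by simpa using h) hD ?_ ?_
    (fun x hx => eval_prod_ne_zero (fun t ht => hT t (Finset.mem_of_mem_erase ht)) hx) (hT _ ht₀)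
    (integrable_div_sub hDc hD hφ (hT _ ht₀) 2) ?_
  · rw [degree_prod]
    simp only [degree_X_sub_C, Finset.sum_const, nsmul_one]
    exact_mod_cast Finset.card_le_card (Finset.erase_subset _ _)
  · rw [eval_prod_X_sub_C]
    exact Finset.prod_ne_zero_iff.2 fun t ht h =>
      Finset.ne_of_mem_erase ht (sub_eq_zero.1 h).symm
  · rw [← hdouble]
    refine integral_congr_ae (Eventually.of_forall fun x => ?_)
    simp only
    rw [show 1 + 1 = 2 from rfl, ← neg_sub t₀ (x : ℂ), neg_sq]

/-- A real function with `N` orthogonality relations has `N` zeros inside the interval. -/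
theorem IsOrthogonal.le_encard {E : Set ℝ} (h : IsOrthogonal μ φ Q N) (hDc : Convex ℝ D)
    (hED : E ⊆ D) (hDE : interior D ⊆ E) (hE : ∀ᵐ x ∂μ, x ∈ E) (hsupp : μ.support.Infinite)
    (hsuppD : μ.support ⊆ D) (hφ : ContinuousOn φ E) (hφr : ∀ x ∈ E, (φ x).im = 0)
    (hQ0 : ∀ x ∈ E, Q.eval (x : ℂ) ≠ 0) (hQr : ∀ x ∈ E, (Q.eval (x : ℂ)).im = 0) :
    (N : ℕ∞) ≤ {x ∈ interior D | φ x = 0}.encard := by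
  by_contra! hlt
  set G : ℝ → ℝ := fun x => (φ x / Q.eval (x : ℂ)).re with hG
  have hGr : ∀ x ∈ E, φ x / Q.eval (x : ℂ) = (G x : ℂ) := by
    intro x hx
    have h1 : φ x = ((φ x).re : ℂ) := Complex.ext (by simp) (by simp [hφr x hx])
    have h2 : Q.eval (x : ℂ) = ((Q.eval (x : ℂ)).re : ℂ) :=
      Complex.ext (by simp) (by simp [hQr x hx])
    refine Complex.ext (by simp [hG]) ?_
    rw [h1, h2, ← Complex.ofReal_div, Complex.ofReal_im, Complex.ofReal_im]
  have hGc : ContinuousOn G E := by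
    refine Complex.continuous_re.comp_continuousOn (hφ.div ?_ hQ0)
    exact (Q.continuous.comp Complex.continuous_ofReal).continuousOn
  have hG0 : ∀ x ∈ E, G x = 0 ↔ φ x = 0 := by
    intro x hx
    rw [← Complex.ofReal_eq_zero, ← hGr x hx, div_eq_zero_iff, or_iff_left (hQ0 x hx)]
  have hfin : {x ∈ interior D | φ x = 0}.Finite :=
    Set.encard_lt_top_iff.1 (hlt.trans_le le_top)
  rw [hfin.encard_eq_coe_toFinset_card] at hlt
  have hlt' : hfin.toFinset.card < N := by exact_mod_cast hlt
  obtain ⟨p, hpd, hp0, hp⟩ := exists_polynomial_mul_nonneg (G := G) hfin.toFinset (interior D)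
    hDc.interior.ordConnected (hGc.mono hDE) (fun x hx => by
      rw [hG0 x (hDE hx)]; simp [hx])
  have hcont : ContinuousOn (fun x => p.eval x * G x) E := p.continuous.continuousOn.mul hGc
  have hint : (interior D).Nonempty := by
    obtain ⟨b, -, hb⟩ := exists_mem_interior_of_infinite hDc hsupp hsuppD
    exact ⟨b, hb⟩
  -- The sign is known only in the interior; continuity on `E` carries it to the endpoints that `E`
  -- contains.
  have hnonneg : ∀ x ∈ E, 0 ≤ p.eval x * G x := by
    intro x hx
    have hcl : x ∈ closure (interior D) :=
      (hDc.closure_interior_eq_closure_of_nonempty_interior hint).ge (subset_closure (hED hx))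
    have := mem_closure_iff_nhdsWithin_neBot.1 hcl
    refine ge_of_tendsto (((hcont x hx).mono hDE)) ?_
    filter_upwards [self_mem_nhdsWithin] with y hy using hp y hy
  have hdeg : (p.map (algebraMap ℝ ℂ)).degree < (N : WithBot ℕ) := by
    refine (degree_map_le.trans degree_le_natDegree).trans_lt ?_
    exact_mod_cast hpd.trans_lt hlt'
  obtain ⟨hi, h0⟩ := h _ hdeg
  have e : (fun x : ℝ => (p.map (algebraMap ℝ ℂ)).eval (x : ℂ) * φ x / Q.eval (x : ℂ)) =ᵐ[μ]
      fun x => ((p.eval x * G x : ℝ) : ℂ) := by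
    filter_upwards [hE] with x hx
    rw [mul_div_assoc, hGr x hx, Complex.ofReal_mul]
    congr 1
    rw [eval_map]
    exact eval₂_at_apply (algebraMap ℝ ℂ) x
  rw [integral_congr_ae e, integral_complex_ofReal, Complex.ofReal_eq_zero] at h0
  have hi' : Integrable (fun x => p.eval x * G x) μ := by
    simpa using (hi.congr e).re
  have hae := (integral_eq_zero_iff_of_nonneg_ae (hE.mono hnonneg) hi').1 h0
  -- Vanishing almost everywhere forces zero mass on the interior without the finitely many zeros,
  -- yet an infinite support has a point in this open set.
  set U := interior D \ (hfin.toFinset : Set ℝ) with hU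
  have hUo : IsOpen U := isOpen_interior.sdiff hfin.toFinset.finite_toSet.isClosed
  have hμU : μ U = 0 := by
    refine measure_mono_null (fun x hx => ?_) (ae_iff.1 hae)
    simp only [Pi.zero_apply, Set.mem_ofPred_eq, mul_eq_zero, not_or]
    refine ⟨fun h => hx.2 (hp0 x h), fun h => hx.2 ?_⟩
    simpa [hx.1] using (hG0 x (hDE hx.1)).1 h
  obtain ⟨b, hb, hb'⟩ := exists_mem_interior_of_infinite hDc
    (hsupp.sdiff hfin.toFinset.finite_toSet) (Set.sdiff_subset.trans hsuppD)
  have := (Measure.mem_support_iff_forall b).1 hb.1 U (hUo.mem_nhds ⟨hb', hb.2⟩)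
  exact this.ne' hμU

end Nikishin

namespace Nikishin

/-! ### Intervals and moments of a Nikishin system -/

variable {m n : ℕ} {ε : ℕ → ℤˣ} {μ : ℕ → Measure ℝ}

theorem Δ_of_le {j : ℕ} (h1 : 1 ≤ j) (hj : j ≤ m) : Δ m μ j = convexHull ℝ (μ j).support :=
  if_pos ⟨h1, hj⟩

theorem Δ_succ_self : Δ m μ (m + 1) = ∅ := if_neg (by omega)

theorem convex_Δ (j : ℕ) : Convex ℝ (Δ m μ j) := by
  unfold Δ
  split_ifs
  exacts [convex_convexHull _ _, convex_empty]

theorem isClosed_Δ (j : ℕ) : IsClosed (Δ m μ j) := by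
  unfold Δ
  split_ifs
  exacts [isClosed_convexHull_real Measure.isClosed_support, isClosed_empty]

theorem support_subset_Δ {j : ℕ} (h1 : 1 ≤ j) (hj : j ≤ m) : (μ j).support ⊆ Δ m μ j := by
  rw [Δ_of_le h1 hj]
  exact subset_convexHull _ _

theorem ae_mem_Δ {j : ℕ} (h1 : 1 ≤ j) (hj : j ≤ m) : ∀ᵐ x ∂μ j, x ∈ Δ m μ j := by
  filter_upwards [Measure.support_mem_ae (μ := μ j)] with x hx using support_subset_Δ h1 hj hx

theorem coe_unit_ne_zero (e : ℤˣ) : ((e : ℤ) : ℂ) ≠ 0 := by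
  simp

theorem chain_base (j d : ℕ) : (chain ε μ j d).base = μ j := by
  cases d <;> rfl

theorem cauchy_chain (j d : ℕ) (z : ℂ) :
    cauchy (chain ε μ j d) z = ∫ x, (chain ε μ j d).dens x / (z - x) ∂μ j := by
  rw [cauchy, chain_base]

theorem chain_succ_dens (j d : ℕ) (x : ℝ) :
    (chain ε μ j (d + 1)).dens x = cauchy (chain ε μ (j + 1) d) x * ((ε j : ℤ) : ℂ) := rfl

namespace IsNikishinSystem

variable (hN : IsNikishinSystem m ε μ)
include hN

theorem nonempty_interior_Δ {j : ℕ} (h1 : 1 ≤ j) (hj : j ≤ m) :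
    (interior (Δ m μ j)).Nonempty := by
  obtain ⟨b, -, hb⟩ := exists_mem_interior_of_infinite (convex_Δ j)
    (hN.support_infinite j h1 hj) (support_subset_Δ h1 hj)
  exact ⟨b, hb⟩

theorem nonempty_Δ {j : ℕ} (h1 : 1 ≤ j) (hj : j ≤ m) : (Δ m μ j).Nonempty :=
  (hN.nonempty_interior_Δ h1 hj).mono interior_subset

/-- A common point would be a limit of interior points of `Δ_{j+1}`, so the two intervals would
share a nonempty open set, which is infinite. -/
theorem disjoint_interior_Δ {j : ℕ} (h1 : 1 ≤ j) (hj : j ≤ m) :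
    Disjoint (interior (Δ m μ j)) (Δ m μ (j + 1)) := by
  rcases hj.eq_or_lt with rfl | hj
  · rw [Δ_succ_self]; exact Set.disjoint_empty _
  · rw [Set.disjoint_left]
    intro x hx hx'
    have hcl : x ∈ closure (interior (Δ m μ (j + 1))) :=
      ((convex_Δ (j + 1)).closure_interior_eq_closure_of_nonempty_interior
        (hN.nonempty_interior_Δ (by omega) hj)).ge (subset_closure hx')
    obtain ⟨y, hy, hy'⟩ := mem_closure_iff.1 hcl _ isOpen_interior hx
    have hinf := infinite_of_mem_nhds y
      ((isOpen_interior.inter isOpen_interior).mem_nhds ⟨hy, hy'⟩)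
    exact hinf (((hN.inter j h1 hj).anti
      (Set.inter_subset_inter interior_subset interior_subset)).finite)

theorem ae_mem_diff {j : ℕ} (h1 : 1 ≤ j) (hj : j ≤ m) :
    ∀ᵐ x ∂μ j, x ∈ Δ m μ j \ Δ m μ (j + 1) := by
  rcases hj.eq_or_lt with rfl | hj'
  · rw [Δ_succ_self]; simpa using ae_mem_Δ h1 hj
  · have h0 : μ j (Δ m μ j ∩ Δ m μ (j + 1)) = 0 := by
      rcases (hN.inter j h1 hj').eq_empty_or_singleton with h | ⟨x, h⟩
      · rw [h, measure_empty]
      · rw [h]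
        exact (hN.no_mass j h1 hj' x (h ▸ Set.mem_singleton x)).1
    filter_upwards [ae_mem_Δ h1 hj, compl_mem_ae_iff.2 h0] with x hx hx'
    exact ⟨hx, fun h => hx' ⟨hx, h⟩⟩

/-- The measures `s_{j,k}` have finite moments. -/
theorem integrable_pow_mul_dens (d : ℕ) : ∀ j, 1 ≤ j → j + d ≤ m → ∀ ν : ℕ,
    Integrable (fun x : ℝ => (x : ℂ) ^ ν * (chain ε μ j d).dens x) (μ j) := by
  induction d with
  | zero =>
    intro j h1 hj ν
    have := ((hN.moments j h1 (by omega) ν).ofReal (𝕜 := ℂ)).mul_const ((ε j : ℤ) : ℂ)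
    simpa [chain, gen] using this
  | succ d ih =>
    intro j h1 hj ν
    simp only [chain_succ_dens, ← mul_assoc]
    refine Integrable.mul_const ?_ _
    have hint : Integrable (fun x : ℝ => cauchy (chain ε μ (j + 1) d) (x : ℂ)) (μ j) := by
      have := hN.integrable j (j + 1 + d) h1 (by omega) (by omega)
      simpa [s] using this
    have hdens : Integrable (chain ε μ (j + 1) d).dens (μ (j + 1)) := by
      simpa using ih (j + 1) (by omega) (by omega) 0
    -- The point `c` splits the estimate. Within distance `1` of `c` the power is bounded and the
    -- transform is integrable by hypothesis; farther away `|x - y| ≥ 1` bounds the transform by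
    -- `K`, and the moments of `μ j` suffice.
    obtain ⟨c, hc⟩ := exists_separation (convex_Δ j) (convex_Δ (j + 1))
      (hN.nonempty_interior_Δ h1 (by omega)) (hN.nonempty_interior_Δ (by omega) (by omega))
      (hN.disjoint_interior_Δ h1 (by omega))
    set K := ∫ x, ‖(chain ε μ (j + 1) d).dens x‖ ∂μ (j + 1) with hK
    have hK0 : 0 ≤ K := integral_nonneg fun _ => norm_nonneg _
    have hbound : Integrable (fun x : ℝ => (|c| + 1) ^ ν * ‖cauchy (chain ε μ (j + 1) d) (x : ℂ)‖ +
        K * |x ^ ν|) (μ j) :=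
      (hint.norm.const_mul _).add ((hN.moments j h1 (by omega) ν).abs.const_mul _)
    refine hbound.mono' ?_ ?_
    · have : Continuous fun x : ℝ => (x : ℂ) ^ ν := by fun_prop
      exact this.aestronglyMeasurable.mul hint.1
    · filter_upwards [ae_mem_Δ h1 (show j ≤ m by omega)] with x hx
      rw [norm_mul, norm_pow, Complex.norm_real, Real.norm_eq_abs, abs_pow]
      rcases le_total |x - c| 1 with h | h
      · have hxc : |x| ≤ |c| + 1 := by
          have := abs_sub_abs_le_abs_sub x c
          linarith
        have := mul_le_mul_of_nonneg_right (pow_le_pow_left₀ (abs_nonneg x) hxc ν)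
          (norm_nonneg (cauchy (chain ε μ (j + 1) d) (x : ℂ)))
        have h' : 0 ≤ K * |x| ^ ν := by positivity
        linarith
      · have h2 : ‖cauchy (chain ε μ (j + 1) d) (x : ℂ)‖ ≤ K := by
          rw [cauchy_chain]
          refine (norm_integral_div_le (ae_mem_Δ (m := m) (by omega) (by omega)) hdens one_pos
            fun y hy => ?_).trans (by rw [div_one])
          rw [← Complex.ofReal_sub, Complex.norm_real, Real.norm_eq_abs]
          exact h.trans (hc x hx y hy)
        have h3 := mul_le_mul_of_nonneg_left h2 (pow_nonneg (abs_nonneg x) ν)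
        have h' : 0 ≤ (|c| + 1) ^ ν * ‖cauchy (chain ε μ (j + 1) d) (x : ℂ)‖ := by positivity
        linarith

end IsNikishinSystem

/-! ### Chains of Cauchy transforms -/

/-- Functions `f_0, …, f_m` such that `f_j` is the Cauchy transform of `f_{j+1} dσ_{j+1}`. -/
structure IsChain (m : ℕ) (ε : ℕ → ℤˣ) (μ : ℕ → Measure ℝ) (f : ℕ → ℂ → ℂ) : Prop where
  integrable : ∀ j, 1 ≤ j → j ≤ m → ∀ ν : ℕ,
    Integrable (fun x : ℝ => (x : ℂ) ^ ν * f j (x : ℂ)) (μ j)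
  eq_integral : ∀ j, j < m → ∀ z ∉ toPlane (Δ m μ (j + 1)),
    f j z = ((ε (j + 1) : ℤ) : ℂ) * ∫ x, f (j + 1) ((x : ℝ) : ℂ) / (z - x) ∂μ (j + 1)
  continuous : Continuous (f m)

namespace IsChain

variable {f g : ℕ → ℂ → ℂ}

theorem integrable_self (hf : IsChain m ε μ f) {j : ℕ} (h1 : 1 ≤ j) (hj : j ≤ m) :
    Integrable (fun x : ℝ => f j (x : ℂ)) (μ j) := by
  simpa using hf.integrable j h1 hj 0

theorem const_mul (hf : IsChain m ε μ f) (b : ℂ) : IsChain m ε μ fun j z => b * f j z where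
  integrable j h1 hj ν := by
    refine ((hf.integrable j h1 hj ν).const_mul b).congr (Eventually.of_forall fun x => ?_)
    simp only; ring
  eq_integral j hj z hz := by
    simp only [mul_div_assoc, integral_const_mul]
    rw [hf.eq_integral j hj z hz]; ring
  continuous := continuous_const.mul hf.continuous

theorem add (hf : IsChain m ε μ f) (hg : IsChain m ε μ g) :
    IsChain m ε μ fun j z => f j z + g j z where
  integrable j h1 hj ν := by
    refine ((hf.integrable j h1 hj ν).add (hg.integrable j h1 hj ν)).congr
      (Eventually.of_forall fun x => ?_)
    simp only [Pi.add_apply]; ring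
  eq_integral j hj z hz := by
    simp only [add_div]
    rw [integral_add, hf.eq_integral j hj z hz, hg.eq_integral j hj z hz, mul_add]
    · exact integrable_div (isClosed_Δ _) (ae_mem_Δ (by omega) hj)
        (hf.integrable_self (by omega) hj) hz
    · exact integrable_div (isClosed_Δ _) (ae_mem_Δ (by omega) hj)
        (hg.integrable_self (by omega) hj) hz
  continuous := hf.continuous.add hg.continuous

/-- The measures are real and live on the line, so `z ↦ conj (f_j (conj z))` commutes with the
transforms. Adding a chain to its reflection makes it real on the line. -/
theorem reflect (hf : IsChain m ε μ f) :
    IsChain m ε μ fun j z => starRingEnd ℂ (f j (starRingEnd ℂ z)) where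
  integrable j h1 hj ν := by
    refine ((Complex.conjLIE.toContinuousLinearEquiv.toContinuousLinearMap).integrable_comp
      (hf.integrable j h1 hj ν)).congr (Eventually.of_forall fun x => ?_)
    simp
  eq_integral j hj z hz := by
    rw [hf.eq_integral j hj _ (by rwa [conj_mem_toPlane]), map_mul, ← integral_conj]
    simp
  continuous := Complex.continuous_conj.comp (hf.continuous.comp Complex.continuous_conj)

theorem hasDerivAt (hf : IsChain m ε μ f) {j : ℕ} (hj : j < m) {z : ℂ}
    (hz : z ∉ toPlane (Δ m μ (j + 1))) :
    HasDerivAt (f j) (((ε (j + 1) : ℤ) : ℂ) *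
      ∫ x, -(f (j + 1) ((x : ℝ) : ℂ) / (z - x) ^ 2) ∂μ (j + 1)) z := by
  refine ((hasDerivAt_integral_div (isClosed_Δ _) (ae_mem_Δ (by omega) hj)
    (hf.integrable_self (by omega) hj) hz).const_mul _).congr_of_eventuallyEq ?_
  filter_upwards [(isClosed_toPlane (isClosed_Δ (m := m) (μ := μ) (j + 1))).isOpen_compl.mem_nhds hz]
    with w hw
  exact hf.eq_integral j hj w hw

theorem integral_eq_zero (hf : IsChain m ε μ f) {j : ℕ} (hj : j < m) {z : ℂ}
    (hz : z ∉ toPlane (Δ m μ (j + 1))) (h0 : f j z = 0) :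
    ∫ x, f (j + 1) ((x : ℝ) : ℂ) / (z - x) ∂μ (j + 1) = 0 := by
  rw [hf.eq_integral j hj z hz] at h0
  exact (mul_eq_zero.1 h0).resolve_left (coe_unit_ne_zero _)

/-- Off `Δ_{j+1}` the function is a differentiable Cauchy transform. A common endpoint of the two
intervals is excluded because continuity may fail there; it carries no mass. -/
theorem continuousOn (hf : IsChain m ε μ f) {j : ℕ} (hj : j ≤ m) :
    ContinuousOn (fun x : ℝ => f j (x : ℂ)) (Δ m μ j \ Δ m μ (j + 1)) := by
  rcases hj.eq_or_lt with rfl | hj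
  · exact (hf.continuous.comp Complex.continuous_ofReal).continuousOn
  · intro x hx
    have hz : (x : ℂ) ∉ toPlane (Δ m μ (j + 1)) := fun h => hx.2 (ofReal_mem_toPlane.1 h)
    exact ((hf.hasDerivAt hj hz).continuousAt.comp
      (f := fun x : ℝ => (x : ℂ)) Complex.continuous_ofReal.continuousAt).continuousWithinAt

theorem hasExpansion (hf : IsChain m ε μ f) {j : ℕ} (hj : j < m) :
    HasExpansion (Δ m μ (j + 1)) (f j) (fun i => ((ε (j + 1) : ℤ) : ℂ) *
      ∫ x, (x : ℂ) ^ i * f (j + 1) ((x : ℝ) : ℂ) ∂μ (j + 1)) :=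
  ((hasExpansion_integral_div (isClosed_Δ _) (ae_mem_Δ (by omega) hj)
    (hf.integrable (j + 1) (by omega) hj)).const_mul _).congr (hf.eq_integral j hj)

/-- A chain is real on the real line as soon as its last function is. -/
theorem conj_apply (hN : IsNikishinSystem m ε μ) (hf : IsChain m ε μ f)
    (hr : ∀ z, f m (starRingEnd ℂ z) = starRingEnd ℂ (f m z)) (d : ℕ) :
    ∀ j, j + d = m → ∀ z ∉ toPlane (Δ m μ (j + 1)),
      f j (starRingEnd ℂ z) = starRingEnd ℂ (f j z) := by
  induction d with
  | zero =>
    intro j hj z _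
    obtain rfl : j = m := by omega
    exact hr z
  | succ d ih =>
    intro j hj z hz
    have hae : ∀ᵐ x : ℝ ∂μ (j + 1), starRingEnd ℂ (f (j + 1) x) = f (j + 1) x := by
      filter_upwards [hN.ae_mem_diff (j := j + 1) (by omega) (by omega)] with x hx
      rw [← ih (j + 1) (by omega) x (fun h => hx.2 (ofReal_mem_toPlane.1 h)), Complex.conj_ofReal]
    rw [hf.eq_integral j (by omega) z hz, hf.eq_integral j (by omega) _
      (by rwa [conj_mem_toPlane]), integral_conj_div hae, map_mul]
    simp

theorem im_eq_zero (hN : IsNikishinSystem m ε μ) (hf : IsChain m ε μ f)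
    (hr : ∀ z, f m (starRingEnd ℂ z) = starRingEnd ℂ (f m z)) {j : ℕ} (hj : j ≤ m) {x : ℝ}
    (hx : x ∉ Δ m μ (j + 1)) : (f j x).im = 0 := by
  rw [← Complex.conj_eq_iff_im, ← hf.conj_apply hN hr (m - j) j (by omega) x
    (fun h => hx (ofReal_mem_toPlane.1 h)), Complex.conj_ofReal]

/-- Orthogonality forces zeros of a real chain. -/
theorem exists_zeros (hN : IsNikishinSystem m ε μ) (hf : IsChain m ε μ f)
    (hr : ∀ z, f m (starRingEnd ℂ z) = starRingEnd ℂ (f m z)) {j : ℕ} (h1 : 1 ≤ j) (hj : j ≤ m)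
    {Q : ℂ[X]} {N : ℕ} (hQ0 : ∀ x ∈ Δ m μ j, Q.eval (x : ℂ) ≠ 0)
    (hQr : ∀ x : ℝ, (Q.eval (x : ℂ)).im = 0)
    (h : IsOrthogonal (μ j) (fun x : ℝ => f j (x : ℂ)) Q N) :
    ∃ T : Finset ℝ, T.card = N ∧ ∀ t ∈ T, t ∈ interior (Δ m μ j) ∧ f j (t : ℂ) = 0 := by
  have key := h.le_encard (E := Δ m μ j \ Δ m μ (j + 1)) (convex_Δ j) Set.sdiff_subset
    (fun x hx => ⟨interior_subset hx, Set.disjoint_left.1 (hN.disjoint_interior_Δ h1 hj) hx⟩)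
    (hN.ae_mem_diff h1 hj) (hN.support_infinite j h1 hj) (support_subset_Δ h1 hj)
    (hf.continuousOn hj) (fun x hx => hf.im_eq_zero hN hr hj hx.2)
    (fun x hx => hQ0 x hx.1) (fun x _ => hQr x)
  obtain ⟨T, hT, hTc⟩ := Set.exists_subset_encard_eq key
  have hfin : T.Finite := Set.finite_of_encard_eq_coe hTc
  refine ⟨hfin.toFinset, ?_, fun t ht => hT (hfin.mem_toFinset.1 ht)⟩
  rw [hfin.encard_eq_coe_toFinset_card] at hTc
  exact_mod_cast hTc

end IsChain

theorem im_eval_prod {T : Finset ℂ} (hT : T.image (starRingEnd ℂ) = T) (x : ℝ) :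
    ((∏ t ∈ T, (X - C t)).eval (x : ℂ)).im = 0 := by
  rw [eval_prod_X_sub_C, ← Complex.conj_eq_iff_im, map_prod]
  conv_rhs => rw [← hT, Finset.prod_image (fun _ _ _ _ h => (starRingEnd ℂ).injective h)]
  simp

theorem image_conj_image_ofReal (T : Finset ℝ) :
    (T.image (fun x : ℝ => (x : ℂ))).image (starRingEnd ℂ) = T.image (fun x : ℝ => (x : ℂ)) := by
  rw [Finset.image_image]
  congr 1
  ext x
  simp

namespace IsChain

variable {f : ℕ → ℂ → ℂ}

/-- The number of relations is preserved from level to level: zeros of `f_k` inside `Δ_k` are off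
`Δ_{k+1}`, so they annihilate the transform of `f_{k+1}` and become relations with a real
denominator, which force as many zeros of `f_{k+1}`. -/
theorem exists_zeros_of_le (hN : IsNikishinSystem m ε μ) (hf : IsChain m ε μ f)
    (hr : ∀ z, f m (starRingEnd ℂ z) = starRingEnd ℂ (f m z)) {j : ℕ} (h1 : 1 ≤ j)
    {Q : ℂ[X]} {N : ℕ} (hQ0 : ∀ x ∈ Δ m μ j, Q.eval (x : ℂ) ≠ 0)
    (hQr : ∀ x : ℝ, (Q.eval (x : ℂ)).im = 0)
    (h : IsOrthogonal (μ j) (fun x : ℝ => f j (x : ℂ)) Q N) {k : ℕ} (hjk : j ≤ k) :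
    k ≤ m → ∃ T : Finset ℝ, T.card = N ∧ ∀ t ∈ T, t ∈ interior (Δ m μ k) ∧ f k (t : ℂ) = 0 := by
  induction k, hjk using Nat.le_induction with
  | base => exact fun hj => hf.exists_zeros hN hr h1 hj hQ0 hQr h
  | succ k hjk ih =>
    intro hk
    obtain ⟨T, hTc, hT⟩ := ih (by omega)
    have hT1 : ∀ t ∈ T.image (fun x : ℝ => (x : ℂ)), t ∉ toPlane (Δ m μ (k + 1)) := by
      intro t ht ht'
      obtain ⟨x, hx, rfl⟩ := Finset.mem_image.1 ht
      exact Set.disjoint_left.1 (hN.disjoint_interior_Δ (by omega) (by omega)) (hT x hx).1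
        (ofReal_mem_toPlane.1 ht')
    have horth := isOrthogonal_prod (isClosed_Δ (k + 1)) (ae_mem_Δ (by omega) hk)
      (hf.integrable_self (by omega) hk) (T.image (fun x : ℝ => (x : ℂ))) hT1 (fun t ht => by
        have ht' := hT1 t ht
        obtain ⟨x, hx, rfl⟩ := Finset.mem_image.1 ht
        exact hf.integral_eq_zero (by omega) ht' (hT x hx).2)
    rw [Finset.card_image_of_injective _ Complex.ofReal_injective, hTc] at horth
    exact hf.exists_zeros hN hr (by omega) hk (fun x hx => eval_prod_ne_zero hT1 hx)
      (im_eval_prod (image_conj_image_ofReal T)) horth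

/-- The number of orthogonality relations is at most the degree of the last function. -/
theorem le_natDegree (hN : IsNikishinSystem m ε μ) (hf : IsChain m ε μ f)
    (hr : ∀ z, f m (starRingEnd ℂ z) = starRingEnd ℂ (f m z)) {P : ℂ[X]} (hP : P ≠ 0)
    (hfP : ∀ z, f m z = P.eval z) {j : ℕ} (h1 : 1 ≤ j) (hj : j ≤ m)
    {Q : ℂ[X]} {N : ℕ} (hQ0 : ∀ x ∈ Δ m μ j, Q.eval (x : ℂ) ≠ 0)
    (hQr : ∀ x : ℝ, (Q.eval (x : ℂ)).im = 0)
    (h : IsOrthogonal (μ j) (fun x : ℝ => f j (x : ℂ)) Q N) : N ≤ P.natDegree := by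
  obtain ⟨T, rfl, hT⟩ := hf.exists_zeros_of_le hN hr h1 hQ0 hQr h hj le_rfl
  rw [← Finset.card_image_of_injective T Complex.ofReal_injective]
  refine (Finset.card_le_card fun t ht => ?_).trans
    ((Multiset.toFinset_card_le _).trans (card_roots' P))
  obtain ⟨x, hx, rfl⟩ := Finset.mem_image.1 ht
  rw [Multiset.mem_toFinset, mem_roots hP, IsRoot.def, ← hfP]
  exact (hT x hx).2

end IsChain

end Nikishin

namespace Nikishin

/-! ### Symmetrization -/

variable {m n : ℕ} {ε : ℕ → ℤˣ} {μ : ℕ → Measure ℝ}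

theorem eval_map_conj (p : ℂ[X]) (z : ℂ) :
    (p.map (starRingEnd ℂ)).eval z = starRingEnd ℂ (p.eval (starRingEnd ℂ z)) := by
  induction p using Polynomial.induction_on' with
  | add p q hp hq => simp [hp, hq]
  | monomial n c => simp

theorem IsOrthogonal.conj {ν : Measure ℝ} {φ : ℝ → ℂ} {N : ℕ} (h : IsOrthogonal ν φ 1 N) :
    IsOrthogonal ν (fun x => starRingEnd ℂ (φ x)) 1 N := by
  intro p hp
  obtain ⟨hi, h0⟩ := h (p.map (starRingEnd ℂ)) (degree_map_le.trans_lt hp)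
  have e : (fun x : ℝ => p.eval (x : ℂ) * starRingEnd ℂ (φ x) / (1 : ℂ[X]).eval (x : ℂ)) =
      fun x : ℝ => starRingEnd ℂ
        ((p.map (starRingEnd ℂ)).eval (x : ℂ) * φ x / (1 : ℂ[X]).eval (x : ℂ)) := by
    funext x
    simp [eval_map_conj]
  rw [e, integral_conj, h0, map_zero]
  refine ⟨((Complex.conjLIE.toContinuousLinearEquiv.toContinuousLinearMap).integrable_comp
    hi).congr (Eventually.of_forall fun x => ?_), rfl⟩
  simp

theorem IsOrthogonal.add {ν : Measure ℝ} {φ ψ : ℝ → ℂ} {Q : ℂ[X]} {N : ℕ}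
    (h : IsOrthogonal ν φ Q N) (h' : IsOrthogonal ν ψ Q N) :
    IsOrthogonal ν (fun x => φ x + ψ x) Q N := by
  intro p hp
  obtain ⟨hi, h0⟩ := h p hp
  obtain ⟨hi', h0'⟩ := h' p hp
  simp only [mul_add, add_div]
  exact ⟨hi.add hi', by rw [integral_add hi hi', h0, h0', add_zero]⟩

theorem IsOrthogonal.const_mul {ν : Measure ℝ} {φ : ℝ → ℂ} {Q : ℂ[X]} {N : ℕ}
    (h : IsOrthogonal ν φ Q N) (b : ℂ) : IsOrthogonal ν (fun x => b * φ x) Q N := by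
  intro p hp
  obtain ⟨hi, h0⟩ := h p hp
  have e : (fun x : ℝ => p.eval (x : ℂ) * (b * φ x) / Q.eval (x : ℂ)) =
      fun x : ℝ => b * (p.eval (x : ℂ) * φ x / Q.eval (x : ℂ)) := by
    funext x; ring
  rw [e]
  exact ⟨hi.const_mul b, by rw [integral_const_mul, h0, mul_zero]⟩

namespace IsChain

variable {f : ℕ → ℂ → ℂ} {P : ℂ[X]} {N : ℕ}

/-- The chain plus its reflection is real and keeps the `N` relations, but its last polynomial has
degree below `N`; a nonzero one would contradict `le_natDegree`. -/
theorem add_map_conj_eq_zero (hm : 1 ≤ m) (hN : IsNikishinSystem m ε μ) (hf : IsChain m ε μ f)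
    (hfP : ∀ z, f m z = P.eval z) (hdeg : P.degree < (N : WithBot ℕ))
    (horth : IsOrthogonal (μ 1) (fun x : ℝ => f 1 (x : ℂ)) 1 N) :
    P + P.map (starRingEnd ℂ) = 0 := by
  by_contra h0
  have horth' := horth.add horth.conj
  have hle := (hf.add hf.reflect).le_natDegree hN (P := P + P.map (starRingEnd ℂ)) (j := 1)
    (Q := 1) (N := N) (fun z => by simp [add_comm]) h0
    (fun z => by simp only [eval_add, eval_map_conj, hfP]) le_rfl hm (by simp) (by simp)
    (by simpa using horth')
  have hlt : (P + P.map (starRingEnd ℂ)).degree < (N : WithBot ℕ) :=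
    (degree_add_le _ _).trans_lt (max_lt hdeg (degree_map_le.trans_lt hdeg))
  exact absurd hle (not_le.2 ((natDegree_lt_iff_degree_lt h0).2 hlt))

/-- With more orthogonality relations than its degree allows, the last function vanishes. -/
theorem eq_zero_of_degree_lt (hm : 1 ≤ m) (hN : IsNikishinSystem m ε μ) (hf : IsChain m ε μ f)
    (hfP : ∀ z, f m z = P.eval z) (hdeg : P.degree < (N : WithBot ℕ))
    (horth : IsOrthogonal (μ 1) (fun x : ℝ => f 1 (x : ℂ)) 1 N) : P = 0 := by
  have h1 := hf.add_map_conj_eq_zero hm hN hfP hdeg horth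
  -- Multiplication by `i` exchanges real and imaginary parts, so this treats `P - conj P`.
  have h2 := (hf.const_mul Complex.I).add_map_conj_eq_zero hm hN (P := C Complex.I * P) (N := N)
    (fun z => by simp [hfP])
    (by rw [← smul_eq_C_mul]; exact (degree_smul_le _ _).trans_lt hdeg) (horth.const_mul _)
  have h3 : C Complex.I * (P - P.map (starRingEnd ℂ)) = 0 := by
    rw [← h2]; simp; ring
  have h4 := (mul_eq_zero.1 h3).resolve_left (C_ne_zero.2 Complex.I_ne_zero)
  have h5 : (2 : ℂ[X]) * P = 0 := by linear_combination h1 + h4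
  exact (mul_eq_zero.1 h5).resolve_left two_ne_zero

/-! ### Zeros of real chains -/

section Real

variable (hN : IsNikishinSystem m ε μ) (hf : IsChain m ε μ f)
  (hr : ∀ z, f m (starRingEnd ℂ z) = starRingEnd ℂ (f m z)) (hP : P ≠ 0)
  (hfP : ∀ z, f m z = P.eval z) (hdeg : P.natDegree ≤ n)
  (horth : IsOrthogonal (μ 1) (fun x : ℝ => f 1 (x : ℂ)) 1 n)
include hN hf hr hP hfP hdeg horth

/-- A zero comes with its conjugate, and the pair gives a real denominator and additional relations
beyond the first `n`. For real `z` the pair collapses to one point, which is still one relation too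
many. -/
theorem ne_zero_of_notMem (hm : 1 ≤ m) {z : ℂ} (hz : z ∉ toPlane (Δ m μ 1)) : f 0 z ≠ 0 := by
  intro h0
  have hT : ∀ t ∈ ({z, starRingEnd ℂ z} : Finset ℂ), t ∉ toPlane (Δ m μ 1) ∧ f 0 t = 0 := by
    intro t ht
    rcases Finset.mem_insert.1 ht with rfl | ht
    · exact ⟨hz, h0⟩
    · rw [Finset.mem_singleton.1 ht, conj_mem_toPlane,
        hf.conj_apply hN hr m 0 (zero_add m) z hz, h0, map_zero]
      exact ⟨hz, rfl⟩
  have h := horth.mul_prod (isClosed_Δ 1) (ae_mem_Δ le_rfl hm) (hf.integrable_self le_rfl hm)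
    {z, starRingEnd ℂ z} (fun t ht => (hT t ht).1)
    (fun t ht => hf.integral_eq_zero (j := 0) (by omega) (hT t ht).1 (hT t ht).2)
  have hle := hf.le_natDegree hN hr hP hfP le_rfl hm
    (fun x hx => eval_prod_ne_zero (fun t ht => (hT t ht).1) hx)
    (im_eval_prod (by simp [Finset.image_insert, Finset.pair_comm])) h
  have : 0 < ({z, starRingEnd ℂ z} : Finset ℂ).card := Finset.card_pos.2 ⟨z, by simp⟩
  omega

/-- A vanishing `n`-th moment would extend orthogonality to test polynomials of degree `n`. -/
theorem integral_pow_ne_zero (hm : 1 ≤ m) :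
    ∫ x, ((x : ℝ) : ℂ) ^ n * f 1 (x : ℂ) ∂μ 1 ≠ 0 := by
  intro h0
  have h : IsOrthogonal (μ 1) (fun x : ℝ => f 1 (x : ℂ)) 1 (n + 1) := by
    intro p hp
    have hsplit : p = C (p.coeff n) * X ^ n + (p - C (p.coeff n) * X ^ n) := by ring
    have hlt : (p - C (p.coeff n) * X ^ n).degree < (n : WithBot ℕ) := by
      rw [degree_lt_iff_coeff_zero]
      intro k hk
      rw [coeff_sub, coeff_C_mul, coeff_X_pow]
      rcases hk.eq_or_lt with rfl | hk
      · simp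
      · rw [coeff_eq_zero_of_degree_lt (hp.trans_le (by exact_mod_cast hk)), if_neg hk.ne']
        simp
    obtain ⟨hi, hz⟩ := horth _ hlt
    have e : (fun x : ℝ => p.eval (x : ℂ) * f 1 (x : ℂ) / (1 : ℂ[X]).eval (x : ℂ)) =
        fun x : ℝ => p.coeff n * ((x : ℂ) ^ n * f 1 (x : ℂ)) +
          (p - C (p.coeff n) * X ^ n).eval (x : ℂ) * f 1 (x : ℂ) / (1 : ℂ[X]).eval (x : ℂ) := by
      funext x
      simp; ring
    have hi' := (hf.integrable 1 le_rfl hm n).const_mul (p.coeff n)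
    rw [e]
    exact ⟨hi'.add hi, by rw [integral_add hi' hi, integral_const_mul, h0, hz]; simp⟩
  have := hf.le_natDegree hN hr hP hfP le_rfl hm (by simp) (by simp) h
  omega

/-- The `n` zeros of `f_j` give `n` relations for `f_{j+1}` with a monic denominator of degree `n`;
a vanishing integral would supply one more. -/
theorem integral_ne_zero {j : ℕ} (h1 : 1 ≤ j) (hj : j < m) :
    ∫ x, f (j + 1) ((x : ℝ) : ℂ) ∂μ (j + 1) ≠ 0 := by
  intro h0
  obtain ⟨T, hTc, hT⟩ := hf.exists_zeros_of_le hN hr le_rfl (by simp) (by simp) horth h1 hj.le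
  have hT1 : ∀ t ∈ T.image (fun x : ℝ => (x : ℂ)), t ∉ toPlane (Δ m μ (j + 1)) ∧ f j t = 0 := by
    intro t ht
    obtain ⟨x, hx, rfl⟩ := Finset.mem_image.1 ht
    exact ⟨fun ht' => Set.disjoint_left.1 (hN.disjoint_interior_Δ h1 hj.le) (hT x hx).1
      (ofReal_mem_toPlane.1 ht'), (hT x hx).2⟩
  have hcard : (T.image (fun x : ℝ => (x : ℂ))).card = n := by
    rw [Finset.card_image_of_injective _ Complex.ofReal_injective, hTc]
  have h := isOrthogonal_prod (isClosed_Δ (j + 1)) (ae_mem_Δ (by omega) hj)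
    (hf.integrable_self (by omega) hj) _ (fun t ht => (hT1 t ht).1)
    (fun t ht => hf.integral_eq_zero hj (hT1 t ht).1 (hT1 t ht).2)
  have h' := h.succ_of_integral_eq_zero (monic_prod_of_monic _ _ fun t _ => monic_X_sub_C t)
    (by rw [natDegree_prod_of_monic _ _ fun t _ => monic_X_sub_C t]; simp)
    ((ae_mem_Δ (by omega) hj).mono fun x hx => eval_prod_ne_zero (fun t ht => (hT1 t ht).1) hx)
    (hf.integrable_self (by omega) hj) h0
  have := hf.le_natDegree hN hr hP hfP (by omega) hj
    (fun x hx => eval_prod_ne_zero (fun t ht => (hT1 t ht).1) hx)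
    (im_eval_prod (image_conj_image_ofReal T)) h'
  omega

theorem exists_finset_zeros {j : ℕ} (h1 : 1 ≤ j) (hj : j ≤ m) :
    ∃ T : Finset ℝ, T.card = n ∧
      {z : ℂ | z ∉ toPlane (Δ m μ (j + 1)) ∧ f j z = 0} = T.image (fun x : ℝ => (x : ℂ)) ∧
      ∀ t ∈ T, t ∈ interior (Δ m μ j) ∧ deriv (f j) t ≠ 0 := by
  obtain ⟨T, hTc, hT⟩ := hf.exists_zeros_of_le hN hr le_rfl (by simp) (by simp) horth h1 hj
  have hT1 : ∀ t ∈ T.image (fun x : ℝ => (x : ℂ)), t ∉ toPlane (Δ m μ (j + 1)) ∧ f j t = 0 := by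
    intro t ht
    obtain ⟨x, hx, rfl⟩ := Finset.mem_image.1 ht
    exact ⟨fun ht' => Set.disjoint_left.1 (hN.disjoint_interior_Δ h1 hj) (hT x hx).1
      (ofReal_mem_toPlane.1 ht'), (hT x hx).2⟩
  have hcard : (T.image (fun x : ℝ => (x : ℂ))).card = n := by
    rw [Finset.card_image_of_injective _ Complex.ofReal_injective, hTc]
  have main : (∀ z, z ∉ toPlane (Δ m μ (j + 1)) → f j z = 0 →
      z ∈ T.image (fun x : ℝ => (x : ℂ))) ∧
      ∀ t ∈ T.image (fun x : ℝ => (x : ℂ)), deriv (f j) t ≠ 0 := by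
    rcases hj.eq_or_lt with rfl | hj
    -- At the last level, `n` distinct roots of a nonzero polynomial of degree at most `n` are all
    -- its roots, and they are simple.
    · have hsub : T.image (fun x : ℝ => (x : ℂ)) ⊆ P.roots.toFinset := fun t ht => by
        rw [Multiset.mem_toFinset, mem_roots hP, IsRoot.def, ← hfP]
        exact (hT1 t ht).2
      have hroots := card_roots' P
      have htf := Multiset.toFinset_card_le P.roots
      have heq : T.image (fun x : ℝ => (x : ℂ)) = P.roots.toFinset :=
        Finset.eq_of_subset_of_card_le hsub (by omega)
      have hnodup : P.roots.Nodup := by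
        rw [← Multiset.toFinset_card_eq_card_iff_nodup, ← heq]
        have := Finset.card_le_card hsub
        omega
      refine ⟨fun z _ hz => ?_, fun t ht h0 => ?_⟩
      · rw [heq, Multiset.mem_toFinset, mem_roots hP, IsRoot.def, ← hfP, hz]
      · have hfP' : f j = fun z => P.eval z := funext hfP
        rw [hfP', Polynomial.deriv] at h0
        have hroot : P.IsRoot t := by rw [IsRoot.def, ← hfP]; exact (hT1 t ht).2
        have h2 := (one_lt_rootMultiplicity_iff_isRoot hP).2 ⟨hroot, h0⟩
        rw [← count_roots] at h2
        exact absurd (Multiset.nodup_iff_count_le_one.1 hnodup t) (not_le.2 h2)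
    · have hzero : ∀ t, t ∉ toPlane (Δ m μ (j + 1)) ∧ f j t = 0 →
          ∫ x, f (j + 1) ((x : ℝ) : ℂ) / (t - x) ∂μ (j + 1) = 0 := fun t ht =>
        hf.integral_eq_zero hj ht.1 ht.2
      refine ⟨fun z hz hz0 => ?_, fun t ht h0 => ?_⟩
      · by_contra hzT
        -- The conjugate is adjoined as well, to keep the denominator real.
        set T' := insert z (insert (starRingEnd ℂ z) (T.image (fun x : ℝ => (x : ℂ)))) with hT'
        have hT2 : ∀ t ∈ T', t ∉ toPlane (Δ m μ (j + 1)) ∧ f j t = 0 := by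
          intro t ht
          rcases Finset.mem_insert.1 ht with rfl | ht
          · exact ⟨hz, hz0⟩
          rcases Finset.mem_insert.1 ht with rfl | ht
          · rw [conj_mem_toPlane, hf.conj_apply hN hr (m - j) j (by omega) z hz, hz0, map_zero]
            exact ⟨hz, rfl⟩
          · exact hT1 t ht
        have himage : T'.image (starRingEnd ℂ) = T' := by
          rw [hT', Finset.image_insert, Finset.image_insert, image_conj_image_ofReal,
            Complex.conj_conj, Finset.insert_comm]
        have h := isOrthogonal_prod (isClosed_Δ (j + 1)) (ae_mem_Δ (by omega) hj)
          (hf.integrable_self (by omega) hj) T' (fun t ht => (hT2 t ht).1)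
          (fun t ht => hzero t (hT2 t ht))
        have hle := hf.le_natDegree hN hr hP hfP (by omega) hj
          (fun x hx => eval_prod_ne_zero (fun t ht => (hT2 t ht).1) hx) (im_eval_prod himage) h
        have hlt : (T.image (fun x : ℝ => (x : ℂ))).card < T'.card :=
          Finset.card_lt_card ⟨fun t ht => Finset.mem_insert_of_mem (Finset.mem_insert_of_mem ht),
            fun h => hzT (h (Finset.mem_insert_self _ _))⟩
        omega
      · have hd : ∫ x, f (j + 1) ((x : ℝ) : ℂ) / (t - x) ^ 2 ∂μ (j + 1) = 0 := by
          rw [(hf.hasDerivAt hj (hT1 t ht).1).deriv, integral_neg] at h0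
          exact neg_eq_zero.1 ((mul_eq_zero.1 h0).resolve_left (coe_unit_ne_zero _))
        have h := isOrthogonal_prod_mul (isClosed_Δ (j + 1)) (ae_mem_Δ (by omega) hj)
          (hf.integrable_self (by omega) hj) _ (fun t ht => (hT1 t ht).1)
          (fun t ht => hzero t (hT1 t ht)) ht hd
        have hle := hf.le_natDegree hN hr hP hfP (by omega) hj (fun x hx => by
          rw [eval_mul]
          refine mul_ne_zero (eval_prod_ne_zero (fun t ht => (hT1 t ht).1) hx) fun h => ?_
          rw [eval_sub, eval_X, eval_C, sub_eq_zero] at h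
          exact (hT1 t ht).1 ⟨x, hx, h⟩) (fun x => by
          obtain ⟨y, -, rfl⟩ := Finset.mem_image.1 ht
          rw [eval_mul, Complex.mul_im, im_eval_prod (image_conj_image_ofReal T)]
          simp) h
        omega
  refine ⟨T, hTc, ?_, fun t ht => ⟨(hT t ht).1, main.2 t (Finset.mem_image_of_mem _ ht)⟩⟩
  ext z
  exact ⟨fun hz => main.1 z hz.1 hz.2, fun hz => hT1 z hz⟩

end Real

end IsChain

/-- The total mass of `s_{j,m}` is not zero. -/
theorem integral_dens_ne_zero (hN : IsNikishinSystem m ε μ) {j : ℕ} (hj : j < m) :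
    ∫ x, (s ε μ (j + 1) m).dens x ∂μ (j + 1) ≠ 0 := by
  -- The transforms of the `s_{j+1,m}`, completed by the constant `1`, form a chain. A zero mass
  -- would be one orthogonality relation against a last polynomial of degree `0`.
  set u : ℕ → ℂ → ℂ := fun j z => if j = m then 1 else cauchy (s ε μ (j + 1) m) z with hu
  have hdens : ∀ j < m, ∀ x : ℝ, (s ε μ (j + 1) m).dens x = ((ε (j + 1) : ℤ) : ℂ) * u (j + 1) x := by
    intro j hj x
    obtain ⟨d, rfl⟩ : ∃ d, m = j + 1 + d := ⟨m - (j + 1), by omega⟩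
    cases d with
    | zero => simp [hu, s, chain, gen]
    | succ d =>
      simp only [hu, s]
      rw [if_neg (by omega), show j + 1 + (d + 1) - (j + 1) = d + 1 by omega,
        show j + 1 + (d + 1) - (j + 1 + 1) = d by omega, chain_succ_dens, mul_comm]
  have hne : ∀ j, ((ε j : ℤ) : ℂ) ≠ 0 := fun j => coe_unit_ne_zero (ε j)
  have hchain : IsChain m ε μ u :=
    { integrable := fun i h1 hi ν => by
        obtain ⟨i, rfl⟩ : ∃ k, i = k + 1 := ⟨i - 1, by omega⟩
        have := (hN.integrable_pow_mul_dens (m - (i + 1)) (i + 1) (by omega) (by omega) ν).const_mul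
          (((ε (i + 1) : ℤ) : ℂ)⁻¹)
        refine this.congr (Eventually.of_forall fun x => ?_)
        have h := hdens i (by omega) x
        simp only [s] at h
        simp only [h]
        field_simp [hne (i + 1)]
      eq_integral := fun i hi z _ => by
        have : u i z = cauchy (s ε μ (i + 1) m) z := by simp only [hu]; rw [if_neg hi.ne]
        rw [this, s, cauchy_chain, ← integral_const_mul]
        refine integral_congr_ae (Eventually.of_forall fun x => ?_)
        have h := hdens i hi x
        simp only [s] at h
        simp only [h, mul_div_assoc]
      continuous := by simpa [hu] using continuous_const }
  intro h0
  have h0' : ∫ x, u (j + 1) ((x : ℝ) : ℂ) ∂μ (j + 1) = 0 := by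
    simp only [hdens j hj, integral_const_mul] at h0
    exact (mul_eq_zero.1 h0).resolve_left (hne _)
  have horth := isOrthogonal_one_zero.succ_of_integral_eq_zero monic_one natDegree_one (by simp)
    (hchain.integrable_self (by omega) hj) h0'
  have hle := hchain.le_natDegree hN (by simp [hu]) (P := 1) one_ne_zero (by simp [hu])
    (by omega) hj (by simp) (by simp) horth
  simp at hle

end Nikishin

namespace Nikishin

/-! ### The forms of multi-level Hermite–Padé approximation -/

variable {m n : ℕ} {ε : ℕ → ℤˣ} {μ : ℕ → Measure ℝ} {a : ℕ → ℂ[X]}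

/-- The forms `𝒜_j`, with `𝒜_m` replaced by `(-1)^m a_m`. -/
noncomputable def signedForm (m : ℕ) (ε : ℕ → ℤˣ) (μ : ℕ → Measure ℝ) (a : ℕ → ℂ[X]) (j : ℕ)
    (z : ℂ) : ℂ :=
  (-1) ^ j * (a j).eval z +
    ∑ k ∈ Finset.Icc (j + 1) m, (-1) ^ k * (a k).eval z * cauchy (s ε μ (j + 1) k) z

theorem signedForm_of_lt {j : ℕ} (hj : j < m) : signedForm m ε μ a j = form m ε μ a j := by
  funext z
  rw [form, if_neg hj.ne, signedForm]

theorem signedForm_self (z : ℂ) : signedForm m ε μ a m z = (-1) ^ m * (a m).eval z := by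
  simp [signedForm]

theorem exists_form_eq_mul_signedForm (j : ℕ) :
    ∃ u : ℂ, u ≠ 0 ∧ ∀ z, form m ε μ a j z = u * signedForm m ε μ a j z := by
  by_cases hj : j = m
  · subst hj
    refine ⟨(-1) ^ j, pow_ne_zero _ (by norm_num), fun z => ?_⟩
    rw [signedForm_self, form, if_pos rfl, ← mul_assoc, ← mul_pow]
    simp
  · exact ⟨1, one_ne_zero, fun z => by rw [form, if_neg hj, signedForm, one_mul]⟩

/-- The density of `𝒜_{j+1} dσ_{j+1}` in terms of those of `s_{j+1,k}`. -/
theorem mul_signedForm_succ {j : ℕ} (hj : j < m) (x : ℝ) :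
    ((ε (j + 1) : ℤ) : ℂ) * signedForm m ε μ a (j + 1) x =
      ∑ k ∈ Finset.Icc (j + 1) m, (-1) ^ k * ((a k).eval (x : ℂ) * (s ε μ (j + 1) k).dens x) := by
  have hI : Finset.Icc (j + 1) m = insert (j + 1) (Finset.Icc (j + 1 + 1) m) := by
    ext k; simp only [Finset.mem_Icc, Finset.mem_insert]; omega
  rw [hI, Finset.sum_insert (by simp), signedForm, mul_add, Finset.mul_sum]
  congr 1
  · simp [s, chain, gen]; ring
  · refine Finset.sum_congr rfl fun k hk => ?_
    obtain ⟨d, rfl⟩ : ∃ d, k = j + 1 + 1 + d := ⟨k - (j + 1 + 1), by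
      have := (Finset.mem_Icc.1 hk).1; omega⟩
    simp only [s]
    rw [show j + 1 + 1 + d - (j + 1 + 1) = d by omega,
      show j + 1 + 1 + d - (j + 1) = d + 1 by omega, chain_succ_dens]
    ring

theorem cauchy_s (j k : ℕ) (z : ℂ) :
    cauchy (s ε μ j k) z = ∫ x, (s ε μ j k).dens x / (z - x) ∂μ j :=
  cauchy_chain _ _ _

theorem IsNikishinSystem.integrable_pow_mul_dens_s (hN : IsNikishinSystem m ε μ) {j k : ℕ}
    (h1 : 1 ≤ j) (hjk : j ≤ k) (hk : k ≤ m) (ν : ℕ) :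
    Integrable (fun x : ℝ => (x : ℂ) ^ ν * (s ε μ j k).dens x) (μ j) :=
  hN.integrable_pow_mul_dens (k - j) j h1 (by omega) ν

theorem integrable_signedForm (hN : IsNikishinSystem m ε μ) {j : ℕ} (h1 : 1 ≤ j) (hj : j ≤ m)
    (ν : ℕ) : Integrable (fun x : ℝ => (x : ℂ) ^ ν * signedForm m ε μ a j x) (μ j) := by
  obtain ⟨j, rfl⟩ : ∃ i, j = i + 1 := ⟨j - 1, by omega⟩
  have hsum : Integrable (fun x : ℝ => ∑ k ∈ Finset.Icc (j + 1) m,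
      (((ε (j + 1) : ℤ) : ℂ)⁻¹ * (-1) ^ k) *
        ((X ^ ν * a k).eval (x : ℂ) * (s ε μ (j + 1) k).dens x)) (μ (j + 1)) := by
    refine integrable_finsetSum _ fun k hk => Integrable.const_mul ?_ _
    have hk' := Finset.mem_Icc.1 hk
    exact integrable_eval_mul (hN.integrable_pow_mul_dens_s h1 hk'.1 hk'.2) _
  refine hsum.congr (Eventually.of_forall fun x => ?_)
  have hne := coe_unit_ne_zero (ε (j + 1))
  have h := mul_signedForm_succ (ε := ε) (μ := μ) (a := a) (j := j) (m := m) (by omega) x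
  have h' : signedForm m ε μ a (j + 1) x = ((ε (j + 1) : ℤ) : ℂ)⁻¹ *
      (((ε (j + 1) : ℤ) : ℂ) * signedForm m ε μ a (j + 1) x) := by
    rw [inv_mul_cancel_left₀ hne]
  simp only
  rw [h', h, Finset.mul_sum, Finset.mul_sum]
  refine Finset.sum_congr rfl fun k _ => ?_
  simp only [eval_mul, eval_pow, eval_X]
  ring

/-- Each product of `a k` with a transform equals the transform with `a k` inside the integral, up
to a polynomial. The densities so obtained add up to that of `𝒜_{j+1} dσ_{j+1}`. -/
theorem exists_signedForm_eq (hN : IsNikishinSystem m ε μ) {j : ℕ} (hj : j < m) :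
    ∃ q : ℂ[X], ∀ z ∉ toPlane (Δ m μ (j + 1)), signedForm m ε μ a j z = q.eval z +
      ((ε (j + 1) : ℤ) : ℂ) *
        ∫ x, signedForm m ε μ a (j + 1) ((x : ℝ) : ℂ) / (z - x) ∂μ (j + 1) := by
  have hmom : ∀ k ∈ Finset.Icc (j + 1) m, ∀ ν : ℕ,
      Integrable (fun x : ℝ => (x : ℂ) ^ ν * (s ε μ (j + 1) k).dens x) (μ (j + 1)) :=
    fun k hk => hN.integrable_pow_mul_dens_s (by omega) (Finset.mem_Icc.1 hk).1
      (Finset.mem_Icc.1 hk).2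
  have hq : ∀ k ∈ Finset.Icc (j + 1) m, ∃ q : ℂ[X], ∀ z ∉ toPlane (Δ m μ (j + 1)),
      (a k).eval z * cauchy (s ε μ (j + 1) k) z = q.eval z +
        ∫ x, (a k).eval ((x : ℝ) : ℂ) * (s ε μ (j + 1) k).dens x / (z - x) ∂μ (j + 1) := by
    intro k hk
    obtain ⟨q, hq⟩ := eval_mul_integral_div (isClosed_Δ (j + 1)) (ae_mem_Δ (by omega) hj)
      (hmom k hk) (a k)
    exact ⟨q, fun z hz => by rw [cauchy_s]; exact hq z hz⟩
  choose! q hq using hq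
  refine ⟨C ((-1) ^ j) * a j + ∑ k ∈ Finset.Icc (j + 1) m, C ((-1) ^ k) * q k, fun z hz => ?_⟩
  have e : ((ε (j + 1) : ℤ) : ℂ) *
      ∫ x, signedForm m ε μ a (j + 1) ((x : ℝ) : ℂ) / (z - x) ∂μ (j + 1) =
      ∑ k ∈ Finset.Icc (j + 1) m, (-1) ^ k *
        ∫ x, (a k).eval ((x : ℝ) : ℂ) * (s ε μ (j + 1) k).dens x / (z - x) ∂μ (j + 1) := by
    simp only [← integral_const_mul]
    rw [← integral_finsetSum]
    · refine integral_congr_ae (Eventually.of_forall fun x => ?_)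
      simp only
      rw [← mul_div_assoc, mul_signedForm_succ hj, Finset.sum_div]
      exact Finset.sum_congr rfl fun k _ => by ring
    · intro k hk
      exact (integrable_div (isClosed_Δ (j + 1)) (ae_mem_Δ (by omega) hj)
        (integrable_eval_mul (hmom k hk) (a k)) hz).const_mul _
  rw [e, signedForm, eval_add, eval_finsetSum, add_assoc, ← Finset.sum_add_distrib]
  congr 1
  · simp
  · refine Finset.sum_congr rfl fun k hk => ?_
    rw [mul_assoc, hq k hk z hz, eval_mul, eval_C, mul_add]

theorem tendsto_zero_of_isBigOInfty {E : Set ℝ} {f : ℂ → ℂ} {N : ℕ}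
    (hf : IsBigOInfty E f (N + 1)) : Tendsto f (nonTangential E 1) (𝓝 0) := by
  refine (hf 1 one_pos).trans_tendsto ?_
  have := (tendsto_inv_nonTangential (E := E) (δ := 1)).pow (N + 1)
  simpa using this

namespace IsMLHermitePade

variable (hN : IsNikishinSystem m ε μ) (ha : IsMLHermitePade m ε μ n a)
include hN ha

omit hN in
theorem tendsto_zero {j : ℕ} (hj : j < m) :
    Tendsto (signedForm m ε μ a j) (nonTangential (Δ m μ (j + 1)) 1) (𝓝 0) := by
  rw [signedForm_of_lt hj]
  rcases Nat.eq_zero_or_pos j with rfl | h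
  · exact tendsto_zero_of_isBigOInfty ha.form_zero
  · exact tendsto_zero_of_isBigOInfty (N := 0) (ha.form_pos j h hj)

theorem isChain : IsChain m ε μ (signedForm m ε μ a) where
  integrable j h1 hj := integrable_signedForm hN h1 hj
  eq_integral j hj := by
    obtain ⟨q, hq⟩ := exists_signedForm_eq (a := a) hN hj
    have hint : Integrable (fun x : ℝ => signedForm m ε μ a (j + 1) x) (μ (j + 1)) := by
      simpa using integrable_signedForm (a := a) hN (j := j + 1) (by omega) hj 0
    -- The form and the transform both tend to zero at infinity, hence so does their difference `q`.
    have hq0 : q = 0 := by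
      refine eq_zero_of_tendsto_eval (hN.nonempty_Δ (j := j + 1) (by omega) hj) ?_
      have h1 := (tendsto_integral_div (ae_mem_Δ (m := m) (by omega) hj) hint one_pos).const_mul
        ((ε (j + 1) : ℤ) : ℂ)
      have h2 := (ha.tendsto_zero hj).sub h1
      rw [mul_zero, sub_zero] at h2
      refine h2.congr' ?_
      filter_upwards [nonTangential_notMem one_pos] with z hz
      rw [hq z hz, add_sub_cancel_right]
    intro z hz
    rw [hq z hz, hq0, eval_zero, zero_add]
  continuous := by
    have : signedForm m ε μ a m = fun z => (-1) ^ m * (a m).eval z := funext signedForm_self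
    rw [this]
    exact continuous_const.mul (a m).continuous

/-- The interpolation condition at infinity gives orthogonality relations for `𝒜_1`. -/
theorem isOrthogonal (hm : 1 ≤ m) :
    IsOrthogonal (μ 1) (fun x : ℝ => signedForm m ε μ a 1 (x : ℂ)) 1 n := by
  have hchain := ha.isChain hN
  have hzero : ∀ i < n, ∫ x, ((x : ℝ) : ℂ) ^ i * signedForm m ε μ a 1 (x : ℂ) ∂μ 1 = 0 := by
    intro i hi
    have h := (hchain.hasExpansion (j := 0) (by omega)).eq_zero_of_isBigO
      (hN.nonempty_Δ le_rfl hm) (by rw [signedForm_of_lt (by omega)]; exact ha.form_zero) i hi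
    exact (mul_eq_zero.1 h).resolve_left (coe_unit_ne_zero _)
  intro p hp
  refine ⟨by simpa using integrable_eval_mul (hchain.integrable 1 le_rfl hm) p, ?_⟩
  by_cases hp0 : p = 0
  · simp [hp0]
  have hpn : p.natDegree < n := (natDegree_lt_iff_degree_lt hp0).2 hp
  simp only [eval_one, div_one, eval_eq_sum_range' hpn, Finset.sum_mul, mul_assoc]
  rw [integral_finsetSum _ fun i _ => (hchain.integrable 1 le_rfl hm i).const_mul _]
  refine Finset.sum_eq_zero fun i hi => ?_
  rw [integral_const_mul, hzero i (Finset.mem_range.1 hi), mul_zero]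

/-- If `a_m` vanishes, then so do all the polynomials. -/
theorem last_ne_zero : a m ≠ 0 := by
  intro h0
  -- Descending induction: when all later polynomials vanish, the form at level `j` is `±a_j`, a
  -- polynomial tending to zero at infinity.
  have hall : ∀ d j, j + d = m → ∀ k, j ≤ k → k ≤ m → a k = 0 := by
    intro d
    induction d with
    | zero =>
      intro j hj k hjk hk
      obtain rfl : k = m := by omega
      exact h0
    | succ d ih =>
      intro j hj k hjk hk
      rcases hjk.eq_or_lt with rfl | hjk
      · have hz : ∀ z, signedForm m ε μ a j z = (-1) ^ j * (a j).eval z := by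
          intro z
          rw [signedForm, Finset.sum_eq_zero, add_zero]
          intro k hk
          rw [ih (j + 1) (by omega) k (Finset.mem_Icc.1 hk).1 (Finset.mem_Icc.1 hk).2]
          simp
        have h := ha.tendsto_zero (j := j) (by omega)
        have h' : Tendsto (fun z => (C ((-1) ^ j) * a j).eval z)
            (nonTangential (Δ m μ (j + 1)) 1) (𝓝 0) := by
          refine h.congr fun z => ?_
          rw [hz, eval_mul, eval_C]
        have := eq_zero_of_tendsto_eval (hN.nonempty_Δ (by omega) (by omega)) h'
        exact (mul_eq_zero.1 this).resolve_left (C_ne_zero.2 (pow_ne_zero _ (by norm_num)))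
      · exact ih (j + 1) (by omega) k hjk hk
  obtain ⟨j, hj, hne⟩ := ha.ne_zero
  exact hne (hall m 0 (by omega) j (Nat.zero_le _) hj)

omit hN in
theorem degree_last_lt : (a m).degree < ((n + 1 : ℕ) : WithBot ℕ) := by
  simpa [multiIndex] using ha.degree_lt m le_rfl

theorem coeff_last_ne_zero (hm : 1 ≤ m) : (a m).coeff n ≠ 0 := by
  intro h0
  have hdeg : (C ((-1) ^ m) * a m).degree < (n : WithBot ℕ) := by
    rw [← smul_eq_C_mul]
    refine (degree_smul_le _ _).trans_lt ?_
    rw [degree_lt_iff_coeff_zero]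
    intro k hk
    rcases hk.eq_or_lt with rfl | hk
    · exact h0
    · exact coeff_eq_zero_of_degree_lt (ha.degree_last_lt.trans_le (by exact_mod_cast hk))
  have := (ha.isChain hN).eq_zero_of_degree_lt hm hN (P := C ((-1) ^ m) * a m)
    (fun z => by rw [signedForm_self, eval_mul, eval_C]) hdeg (ha.isOrthogonal hN hm)
  exact ha.last_ne_zero hN
    ((mul_eq_zero.1 this).resolve_left (C_ne_zero.2 (pow_ne_zero _ (by norm_num))))

/-- Up to a constant factor, the forms are real on the real line. -/
theorem exists_real (hm : 1 ≤ m) : ∃ b : ℂ, b ≠ 0 ∧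
    ∀ z, b * signedForm m ε μ a m (starRingEnd ℂ z) =
      starRingEnd ℂ (b * signedForm m ε μ a m z) := by
  set P : ℂ[X] := C ((-1) ^ m) * a m with hP
  have hPz : ∀ z, signedForm m ε μ a m z = P.eval z := fun z => by
    rw [signedForm_self, hP, eval_mul, eval_C]
  -- With this factor the coefficient of degree `n` becomes real, so it cancels in `R - conj R` and
  -- the degree drops below `n`.
  set b := starRingEnd ℂ (P.coeff n) with hb
  have hPn : P.coeff n ≠ 0 := by
    rw [hP, coeff_C_mul]
    exact mul_ne_zero (pow_ne_zero _ (by norm_num)) (ha.coeff_last_ne_zero hN hm)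
  have hPdeg : P.degree < ((n + 1 : ℕ) : WithBot ℕ) := by
    rw [hP, ← smul_eq_C_mul]
    exact (degree_smul_le _ _).trans_lt ha.degree_last_lt
  set R := C b * P with hR
  have hRz : ∀ z, R.eval z = b * signedForm m ε μ a m z := fun z => by
    rw [hR, eval_mul, eval_C, hPz]
  have hchain := (ha.isChain hN).const_mul b
  have horth := (ha.isOrthogonal hN hm).const_mul b
  have hS := hchain.add (hchain.reflect.const_mul (-1))
  have hSo := horth.add (horth.conj.const_mul (-1))
  have hRdeg : R.degree < ((n + 1 : ℕ) : WithBot ℕ) := by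
    rw [hR, ← smul_eq_C_mul]
    exact (degree_smul_le _ _).trans_lt hPdeg
  have hzero : R - R.map (starRingEnd ℂ) = 0 := by
    refine hS.eq_zero_of_degree_lt hm hN (P := R - R.map (starRingEnd ℂ)) (N := n)
      (fun z => ?_) ?_ (by simpa using hSo)
    · rw [eval_sub, eval_map_conj, hRz, hRz]
      ring
    · rw [degree_lt_iff_coeff_zero]
      intro k hk
      rw [coeff_sub, coeff_map]
      rcases hk.eq_or_lt with rfl | hk
      · rw [hR, coeff_C_mul, map_mul, hb, Complex.conj_conj]; ring
      · rw [coeff_eq_zero_of_degree_lt (hRdeg.trans_le (by exact_mod_cast hk))]; simp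
  refine ⟨b, (_root_.map_ne_zero _).2 hPn, fun z => ?_⟩
  have h := eval_map_conj R (starRingEnd ℂ z)
  rw [← sub_eq_zero.1 hzero, Complex.conj_conj, hRz, hRz] at h
  exact h

/-- Divided by `z^(n-1)`, the form tends to zero. In the limit only the coefficient of `a_j` and the
product of the leading coefficient of `a_m` with the mass of `s_{j+1,m}` survive; the latter product
is nonzero, so the former is too. -/
theorem degree_add_one_of_lt (hn : 1 ≤ n) {j : ℕ} (hj : j < m) :
    (a j).degree + 1 = (n : WithBot ℕ) := by
  have hm : 1 ≤ m := by omega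
  have hdeg : ∀ k, k < m → (a k).natDegree ≤ n - 1 := by
    intro k hk
    by_cases h0 : a k = 0
    · simp [h0]
    · have := ha.degree_lt k hk.le
      rw [multiIndex, if_neg hk.ne, ← natDegree_lt_iff_degree_lt h0] at this
      omega
  have hdegm : (a m).natDegree ≤ n :=
    Nat.lt_succ_iff.1 ((natDegree_lt_iff_degree_lt (ha.last_ne_zero hN)).2 ha.degree_last_lt)
  set E := Δ m μ (j + 1) with hE
  have hEne : E.Nonempty := hN.nonempty_Δ (by omega) hj
  have := nonTangential_neBot hEne
  have hmom : ∀ k ∈ Finset.Icc (j + 1) m, ∀ ν : ℕ,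
      Integrable (fun x : ℝ => (x : ℂ) ^ ν * (s ε μ (j + 1) k).dens x) (μ (j + 1)) :=
    fun k hk => hN.integrable_pow_mul_dens_s (by omega) (Finset.mem_Icc.1 hk).1
      (Finset.mem_Icc.1 hk).2
  set c := ∫ x, (s ε μ (j + 1) m).dens x ∂μ (j + 1) with hc
  -- The degree of `a_m` exceeds `n - 1` by one; the extra power of `z` meets the `1/z` decay of the
  -- transform and picks out the total mass.
  have hlast : Tendsto (fun z => (a m).eval z / z ^ (n - 1) * cauchy (s ε μ (j + 1) m) z)
      (nonTangential E 1) (𝓝 ((a m).coeff n * c)) := by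
    have h1 := hasExpansion_integral_div (isClosed_Δ (m := m) (j + 1)) (ae_mem_Δ (by omega) hj)
      (hmom m (Finset.mem_Icc.2 ⟨hj, le_rfl⟩)) 1 one_pos 0
    have h2 := (tendsto_eval_div_pow (E := E) hdegm).mul h1
    simp only [pow_zero, one_mul, Finset.range_zero, Finset.sum_empty, sub_zero] at h2
    refine h2.congr' ?_
    filter_upwards [nonTangential_eventually] with z hz
    have := hz.1
    rw [cauchy_s, ← mul_assoc, zero_add, pow_one]
    congr 1
    rw [div_mul_eq_mul_div, div_eq_div_iff (pow_ne_zero _ this) (pow_ne_zero _ this), mul_assoc,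
      ← pow_succ', Nat.sub_add_cancel hn]
  have hother : ∀ k ∈ Finset.Ico (j + 1) m,
      Tendsto (fun z => (-1) ^ k * ((a k).eval z / z ^ (n - 1) * cauchy (s ε μ (j + 1) k) z))
        (nonTangential E 1) (𝓝 0) := by
    intro k hk
    have hk' := Finset.mem_Ico.1 hk
    have h1 : Tendsto (cauchy (s ε μ (j + 1) k)) (nonTangential E 1) (𝓝 0) := by
      have hint : Integrable (s ε μ (j + 1) k).dens (μ (j + 1)) := by
        simpa using hmom k (Finset.mem_Icc.2 ⟨hk'.1, hk'.2.le⟩) 0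
      refine (tendsto_integral_div (ae_mem_Δ (m := m) (by omega) hj) hint one_pos).congr
        fun z => (cauchy_s _ _ _).symm
    simpa using ((tendsto_eval_div_pow (E := E) (hdeg k hk'.2)).mul h1).const_mul ((-1) ^ k)
  have htotal := (((tendsto_eval_div_pow (E := E) (hdeg j hj)).const_mul ((-1) ^ j)).add
    (tendsto_finsetSum _ hother)).add (hlast.const_mul ((-1) ^ m))
  have hzero := (ha.tendsto_zero hj).mul
    ((tendsto_inv_nonTangential (E := E) (δ := 1)).pow (n - 1))
  rw [zero_mul] at hzero
  have heq : (-1) ^ j * (a j).coeff (n - 1) + ∑ k ∈ Finset.Ico (j + 1) m, (0 : ℂ) +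
      (-1) ^ m * ((a m).coeff n * c) = 0 := by
    refine tendsto_nhds_unique (htotal.congr fun z => ?_) hzero
    have hI : Finset.Icc (j + 1) m = insert m (Finset.Ico (j + 1) m) := by
      ext k; simp only [Finset.mem_Icc, Finset.mem_insert, Finset.mem_Ico]; omega
    rw [signedForm, hI, Finset.sum_insert (by simp), add_mul, add_mul, Finset.sum_mul, inv_pow]
    have hsum : ∀ k, (-1) ^ k * ((a k).eval z / z ^ (n - 1) * cauchy (s ε μ (j + 1) k) z) =
        (-1) ^ k * (a k).eval z * cauchy (s ε μ (j + 1) k) z * (z ^ (n - 1))⁻¹ :=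
      fun k => by ring
    simp only [hsum]
    ring
  have hcoeff : (a j).coeff (n - 1) ≠ 0 := by
    intro h0
    rw [h0] at heq
    simp only [mul_zero, Finset.sum_const_zero, zero_add] at heq
    exact mul_ne_zero (pow_ne_zero _ (by norm_num)) (mul_ne_zero (ha.coeff_last_ne_zero hN hm)
      (integral_dens_ne_zero hN hj)) heq
  have h0 : a j ≠ 0 := fun h => hcoeff (by simp [h])
  rw [degree_eq_natDegree h0, le_antisymm (hdeg j hj) (le_natDegree_of_ne_zero hcoeff)]
  exact_mod_cast Nat.sub_add_cancel hn

theorem degree_last (hm : 1 ≤ m) : (a m).degree = (n : WithBot ℕ) := by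
  have h0 := ha.last_ne_zero hN
  have h1 := (natDegree_lt_iff_degree_lt h0).2 ha.degree_last_lt
  have h2 := le_natDegree_of_ne_zero (ha.coeff_last_ne_zero hN hm)
  rw [degree_eq_natDegree h0, show (a m).natDegree = n by omega]

end IsMLHermitePade

theorem IsNikishinSystem.isNormalIndex (hN : IsNikishinSystem m ε μ) (hm : 1 ≤ m) (hn : 1 ≤ n) :
    IsNormalIndex m ε μ n := by
  intro a ha j hj
  rcases hj.eq_or_lt with rfl | hj
  · rw [ha.degree_last hN hm, multiIndex, if_pos rfl, Nat.cast_add, Nat.cast_one]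
  · rw [ha.degree_add_one_of_lt hN hn hj, multiIndex, if_neg hj.ne]

end Nikishin

/-! ### The main theorem -/

theorem mainTheorem4 (m n : ℕ) (hm : 1 ≤ m) (hn : 1 ≤ n)
    (ε : ℕ → ℤˣ) (μ : ℕ → Measure ℝ) (hN : Nikishin.IsNikishinSystem m ε μ) :
    (∀ a : ℕ → ℂ[X], Nikishin.IsMLHermitePade m ε μ n a →
      (∀ z : ℂ, z ∉ Nikishin.toPlane (Nikishin.Δ m μ 1) → Nikishin.form m ε μ a 0 z ≠ 0) ∧
      (∃ c : ℕ → ℂ, Nikishin.HasExpansion (Nikishin.Δ m μ 1) (Nikishin.form m ε μ a 0) c ∧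
        (∀ i, i < n → c i = 0) ∧ c n ≠ 0) ∧
      (∀ j, 1 ≤ j → j ≤ m →
        {z : ℂ | z ∉ Nikishin.toPlane (Nikishin.Δ m μ (j + 1)) ∧
          Nikishin.form m ε μ a j z = 0}.encard = (n : ℕ∞) ∧
        ∀ z : ℂ, z ∉ Nikishin.toPlane (Nikishin.Δ m μ (j + 1)) →
          Nikishin.form m ε μ a j z = 0 →
            deriv (Nikishin.form m ε μ a j) z ≠ 0 ∧
            z ∈ Nikishin.toPlane (interior (Nikishin.Δ m μ j))) ∧
      (∀ j, 1 ≤ j → j + 1 ≤ m →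
        ∃ c : ℕ → ℂ,
          Nikishin.HasExpansion (Nikishin.Δ m μ (j + 1)) (Nikishin.form m ε μ a j) c ∧
          c 0 ≠ 0)) ∧
    Nikishin.IsNormalIndex m ε μ n := by
  refine ⟨fun a ha => ?_, hN.isNormalIndex hm hn⟩
  -- The counting results need a real chain, so they are applied to `b` times the forms; a nonzero
  -- factor changes neither the zeros, nor their simplicity, nor the nonvanishing of the
  -- coefficients.
  obtain ⟨b, hb, hreal⟩ := ha.exists_real hN hm
  have hchain := ha.isChain hN
  have hf := hchain.const_mul b
  have horth := (ha.isOrthogonal hN hm).const_mul b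
  have hPne : C (b * (-1) ^ m) * a m ≠ 0 :=
    mul_ne_zero (C_ne_zero.2 (mul_ne_zero hb (pow_ne_zero _ (by norm_num)))) (ha.last_ne_zero hN)
  have hfP : ∀ z, b * Nikishin.signedForm m ε μ a m z = (C (b * (-1) ^ m) * a m).eval z := fun z => by
    rw [Nikishin.signedForm_self, eval_mul, eval_C, mul_assoc]
  have hdeg : (C (b * (-1) ^ m) * a m).natDegree ≤ n :=
    (natDegree_C_mul_le _ _).trans (natDegree_le_of_degree_le (ha.degree_last hN hm).le)
  have hexp : ∀ j, j < m → Nikishin.HasExpansion (Nikishin.Δ m μ (j + 1)) (Nikishin.form m ε μ a j)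
      (fun i => ((ε (j + 1) : ℤ) : ℂ) *
        ∫ x, (x : ℂ) ^ i * Nikishin.signedForm m ε μ a (j + 1) ((x : ℝ) : ℂ) ∂μ (j + 1)) := fun j hj => by
    rw [← Nikishin.signedForm_of_lt hj]
    exact hchain.hasExpansion hj
  refine ⟨fun z hz h0 => ?_, ⟨_, hexp 0 (by omega), ?_, ?_⟩, fun j h1 hj => ?_,
    fun j h1 hj => ⟨_, hexp j hj, ?_⟩⟩
  · refine hf.ne_zero_of_notMem hN hreal hPne hfP hdeg horth hm hz ?_
    rw [Nikishin.signedForm_of_lt (by omega), h0, mul_zero]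
  · exact (hexp 0 (by omega)).eq_zero_of_isBigO (hN.nonempty_Δ le_rfl hm) ha.form_zero
  · refine mul_ne_zero (Nikishin.coe_unit_ne_zero _) fun h => ?_
    refine hf.integral_pow_ne_zero hN hreal hPne hfP hdeg horth hm ?_
    simp only [mul_left_comm _ b, integral_const_mul]
    rw [h, mul_zero]
  · obtain ⟨T, hTc, hT, hT'⟩ := hf.exists_finset_zeros hN hreal hPne hfP hdeg horth h1 hj
    obtain ⟨u, hu, hform⟩ := Nikishin.exists_form_eq_mul_signedForm (m := m) (ε := ε) (μ := μ) (a := a) j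
    have hzeros : {z : ℂ | z ∉ Nikishin.toPlane (Nikishin.Δ m μ (j + 1)) ∧ Nikishin.form m ε μ a j z = 0} =
        T.image (fun x : ℝ => (x : ℂ)) := by
      rw [← hT]
      ext z
      simp [hform, hu, hb]
    refine ⟨?_, fun z hz h0 => ?_⟩
    · rw [hzeros, Set.encard_coe_eq_coe_finsetCard,
        Finset.card_image_of_injective _ Complex.ofReal_injective, hTc]
    · have hmem : z ∈ {z : ℂ | z ∉ Nikishin.toPlane (Nikishin.Δ m μ (j + 1)) ∧ Nikishin.form m ε μ a j z = 0} := ⟨hz, h0⟩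
      rw [hzeros] at hmem
      obtain ⟨t, ht, rfl⟩ := Finset.mem_image.1 (Finset.mem_coe.1 hmem)
      refine ⟨?_, Nikishin.ofReal_mem_toPlane.2 (hT' t ht).1⟩
      have hfun : Nikishin.form m ε μ a j = fun z => u / b * (b * Nikishin.signedForm m ε μ a j z) := by
        funext z
        rw [hform]
        field_simp
      rw [hfun, deriv_const_mul_field]
      exact mul_ne_zero (div_ne_zero hu hb) (hT' t ht).2
  · refine mul_ne_zero (Nikishin.coe_unit_ne_zero _) fun h => ?_
    refine hf.integral_ne_zero hN hreal hPne hfP hdeg horth h1 hj ?_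
    simp only [pow_zero, one_mul] at h
    rw [integral_const_mul, h, mul_zero]
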